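/- Let $D\subset\mathbb R^d$ be a bounded open set (for instance a bounded domain with smooth boundary and $d\le 3$), let $\kappa$ be smooth on $\overline D$ with $\kappa\ge\kappa_0>0$ on $D$, and let $\beta\in\mathbb R$, $k>0$ with $2k\beta^2<1$. Let $H=L_2(D)$ with scalar product $\langle\cdot,\cdot\rangle$ and norm $\|\cdot\|$. Let $Au=-\nabla\cdot(\kappa\nabla u)$ with form $a(u,v)=\int_D\kappa\,\nabla u\cdot\nabla v\,d\xi$ on $H^1_0(D)$, and put $\dot H^1=H^1_0(D)$, $\langle u,v\rangle_1=a(u,v)$, $\|u\|_1=\langle u,u\rangle_1^{1/2}$. For $\varepsilon>0$ let $R_\varepsilon=(I+\varepsilon A)^{-1}$: $R_\varepsilon x$ is the $y\in H^1_0(D)$ with $\langle y,v\rangle+\varepsilon a(y,v)=\langle x,v\rangle$ for all $v\in H^1_0(D)$. Such a $y$ exists and is unique for every $x\in H$. Moreover, if $(e_n)_{n\in\mathbb N}$ is an orthonormal basis of $H$ with $e_n\in H^1_0(D)$, $Ae_n=\lambda_ne_n$, $0<\lambda_n$ nondecreasing and $\lambda_n\to\infty$, then $v\in\dot H^1$ if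 and only if $\sum_n\lambda_n\langle v,e_n\rangle^2<\infty$, and $\langle v,w\rangle_1=\sum_n\lambda_n\langle v,e_n\rangle\langle w,e_n\rangle$ for $v,w\in\dot H^1$. Let $f(u)=u^3-\beta^2u$ with domain $D_f=\{u\in H: f(u)\in H\}$. Then the following hold. 1. For every $x\in H$ the equation $z+kf(z)=x$ has a unique solution $z=:J_k(x)\in L_6(D)$, and $f(z)\in H$. Put $f_k(x)=f(J_k(x))$ and $F_k(x)=R_{k/2}f_k(R_{k/2}x)$ for $x\in H$. If $x\in\dot H^1$, then $z,f(z)\in\dot H^1$. 2. With $C(k)=(1-2k\beta^2)^{-1/2}$, $\|J_k(x)-J_k(y)\|\le C(k)\|x-y\|$ for $x,y\in H$, and $\|J_k(x)\|_1\le C(k)\|x\|_1$ for $x\in\dot H^1$. 3. Let $b=\beta^2/(1-2k\beta^2)$. For $G=f_k$ and for $G=F_k$: $\|G(x)-G(y)\|\le\frac1k\|x-y\|$, $\langle G(x)-G(y),x-y\rangle\ge-b\|x-y\|^2$ and $\langle G(x),x\rangle\ge-b\|x\|^2$ for $x,y\in H$; and $G(x)\in\dot H^1$, $\langle G(x),x\rangle_1\ge-b\|x\|_1^2$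 for $x\in\dot H^1$. 4. $x-J_k(x)=kf_k(x)$ for $x\in H$. 5. For all $\alpha,\gamma>0$ with $2\alpha\beta^2<1$, $2\gamma\beta^2<1$ and all $x,y\in H$, $$\begin{aligned}\langle F_\alpha(x)-F_\gamma(y),x-y\rangle={}&\langle f_\alpha(R_{\alpha/2}x)-f_\gamma(R_{\gamma/2}y),R_{\alpha/2}x-R_{\gamma/2}y\rangle\\&+\langle f_\alpha(R_{\alpha/2}x),(R_{\gamma/2}-R_{\alpha/2})y\rangle+\langle f_\gamma(R_{\gamma/2}y),(R_{\alpha/2}-R_{\gamma/2})x\rangle.\end{aligned}$$ -/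

import Mathlib

open MeasureTheory Filter Topology
open scoped ContDiff ENNReal

noncomputable section

namespace AllenCahn

/-- The Euclidean space `ℝᵈ`. -/
abbrev Space (d : ℕ) : Type := EuclideanSpace ℝ (Fin d)

/-- The Hilbert space `H = L₂(D)` of real functions. -/
abbrev L2 {d : ℕ} (D : Set (Space d)) : Type := Lp ℝ 2 (volume.restrict D)

/-- The Hilbert space `L₂(D; ℝᵈ)` of vector fields. -/
abbrev L2Vec {d : ℕ} (D : Set (Space d)) : Type := Lp (Space d) 2 (volume.restrict D)

/-- Test functions: elements of `C_c^∞(D)`. -/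
def IsTestFunction {d : ℕ} (D : Set (Space d)) (φ : Space d → ℝ) : Prop :=
  ContDiff ℝ ∞ φ ∧ HasCompactSupport φ ∧ tsupport φ ⊆ D

/-- `G` is the weak gradient of `u` in `D`. -/
def HasWeakGradient {d : ℕ} (D : Set (Space d)) (u : L2 D) (G : L2Vec D) : Prop :=
  ∀ φ : Space d → ℝ, IsTestFunction D φ →
    ∫ ξ in D, u ξ • gradient φ ξ = - ∫ ξ in D, φ ξ • G ξ

/-- The Sobolev space `H¹₀(D)`: the functions in `L₂(D)` with weak gradient in `L₂(D)` that are
limits, in the norm of `H¹(D)`, of test functions. -/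
def MemH10 {d : ℕ} (D : Set (Space d)) (u : L2 D) : Prop :=
  ∃ G : L2Vec D, HasWeakGradient D u G ∧
    ∀ ε : ℝ≥0∞, 0 < ε → ∃ φ : Space d → ℝ, IsTestFunction D φ ∧
      eLpNorm (fun ξ => u ξ - φ ξ) 2 (volume.restrict D) < ε ∧
      eLpNorm (fun ξ => G ξ - gradient φ ξ) 2 (volume.restrict D) < ε

open Classical in
/-- The weak gradient of `u` (zero if `u` has none in `L₂`; it is unique when `D` is open). -/
def weakGrad {d : ℕ} (D : Set (Space d)) (u : L2 D) : L2Vec D :=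
  if h : ∃ G : L2Vec D, HasWeakGradient D u G then h.choose else 0

/-- The bilinear form `a(u, v) = (A u, v) = ∫_D κ ∇u · ∇v` of `A u = -∇ · (κ ∇u)`. On `H¹₀(D)` it
is the scalar product `⟨u, v⟩₁`. -/
def form {d : ℕ} (D : Set (Space d)) (κ : Space d → ℝ) (u v : L2 D) : ℝ :=
  ∫ ξ in D, κ ξ * inner ℝ (weakGrad D u ξ) (weakGrad D v ξ)

/-- The norm `‖u‖₁ = ‖A^{1/2} u‖ = a(u, u)^{1/2}` on `H¹₀(D)`. -/
def norm1 {d : ℕ} (D : Set (Space d)) (κ : Space d → ℝ) (u : L2 D) : ℝ :=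
  Real.sqrt (form D κ u u)

/-- A nondecreasing sequence of positive eigenvalues tending to infinity and an orthonormal basis
of corresponding eigenfunctions: `A eₙ = λₙ eₙ` with `eₙ ∈ H¹₀(D)`. -/
structure IsEigenbasis {d : ℕ} (D : Set (Space d)) (κ : Space d → ℝ) (lam : ℕ → ℝ)
    (e : HilbertBasis ℕ ℝ (L2 D)) : Prop where
  monotone : Monotone lam
  pos : ∀ n, 0 < lam n
  tendsto : Tendsto lam atTop atTop
  mem : ∀ n, MemH10 D (e n)
  eigen : ∀ n, ∀ v : L2 D, MemH10 D v → form D κ (e n) v = lam n * inner ℝ (e n) v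

/-- `y ∈ H¹₀(D)` solves `y + ε A y = x`, as an equation in the dual of `H¹₀(D)`. -/
def IsResolventSol {d : ℕ} (D : Set (Space d)) (κ : Space d → ℝ) (ε : ℝ) (x y : L2 D) : Prop :=
  MemH10 D y ∧ ∀ v : L2 D, MemH10 D v → inner ℝ y v + ε * form D κ y v = inner ℝ x v

open Classical in
/-- The resolvent `R_ε = (I + ε A)⁻¹` of `A`. -/
def resolventA {d : ℕ} (D : Set (Space d)) (κ : Space d → ℝ) (ε : ℝ) (x : L2 D) : L2 D :=
  if h : ∃ y : L2 D, IsResolventSol D κ ε x y then h.choose else 0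

/-- The domain `D_f` of `f(u) = u³ - β² u` in `H`. -/
def MemDomF {d : ℕ} (D : Set (Space d)) (β : ℝ) (u : L2 D) : Prop :=
  MemLp (fun ξ => u ξ ^ 3 - β ^ 2 * u ξ) 2 (volume.restrict D)

open Classical in
/-- The operator `f : D_f ⊂ H → H`, `f(u) = u³ - β² u` (zero outside `D_f`). -/
def f {d : ℕ} (D : Set (Space d)) (β : ℝ) (u : L2 D) : L2 D :=
  if h : MemDomF D β u then MemLp.toLp (fun ξ => u ξ ^ 3 - β ^ 2 * u ξ) h else 0

/-- `z ∈ L₆(D)` solves `z + k f(z) = x`. -/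
def IsJSol {d : ℕ} (D : Set (Space d)) (β k : ℝ) (x z : L2 D) : Prop :=
  MemLp z 6 (volume.restrict D) ∧ z + k • f D β z = x

open Classical in
/-- The resolvent `J_k = (I + k f)⁻¹` of `f`. -/
def J {d : ℕ} (D : Set (Space d)) (β k : ℝ) (x : L2 D) : L2 D :=
  if h : ∃ z : L2 D, IsJSol D β k x z then h.choose else 0

/-- The Yosida approximation `f_k = f ∘ J_k`. -/
def fk {d : ℕ} (D : Set (Space d)) (β k : ℝ) (x : L2 D) : L2 D :=
  f D β (J D β k x)

/-- The operator `F_k = R_{k/2} ∘ f_k ∘ R_{k/2}`. -/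
def Fk {d : ℕ} (D : Set (Space d)) (κ : Space d → ℝ) (β k : ℝ) (x : L2 D) : L2 D :=
  resolventA D κ (k / 2) (fk D β k (resolventA D κ (k / 2) x))

/-- The operator `g : H → H` is Lipschitz with constant `L`, and with constant `b` in place of
`β²` it has the one-sided Lipschitz property, the dissipativity property in `H`, and the
dissipativity property in `H¹₀(D)` (which it maps into itself) for `⟨·, ·⟩₁`. -/
structure HasYosidaProperties {d : ℕ} (D : Set (Space d)) (κ : Space d → ℝ) (L b : ℝ)
    (g : L2 D → L2 D) : Prop where
  lipschitz : ∀ x y, ‖g x - g y‖ ≤ L * ‖x - y‖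
  oneSided : ∀ x y, inner ℝ (g x - g y) (x - y) ≥ -b * ‖x - y‖ ^ 2
  dissipative : ∀ x, inner ℝ (g x) x ≥ -b * ‖x‖ ^ 2
  mapsTo : ∀ x, MemH10 D x → MemH10 D (g x)
  dissipative_one : ∀ x, MemH10 D x → form D κ (g x) x ≥ -b * norm1 D κ x ^ 2

end AllenCahn

end

open AllenCahn

noncomputable section

namespace AllenCahn

variable {d : ℕ} {D : Set (Space d)}

/-! ### Test functions -/

/-! The linear part rests on one closed subspace. `gradientGraph` is the closure in `L₂ × L₂` of the
pairs `(φ, ∇φ)` of test functions. Integration by parts survives the closure, and weak gradients are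
unique on an open set, so this closure is exactly the graph of `weakGrad` over `H¹₀(D)`.
Multiplication by `√κ` turns `form` into a scalar product of `L₂` fields, and the graph becomes a
Hilbert space, `energySpace`, with product `⟨u, v⟩ + a(u, v)`. Riesz representation there, with
weight `ε κ`, yields `R_ε`. Parseval there, minus Parseval in `L₂`, yields the spectral description
of `H¹₀(D)`.

The nonlinear part is pointwise. Since `s ↦ s + k (s³ - β² s)` has derivative at least `1 - kβ² >
0`, it has a smooth inverse `g`, Lipschitz with constant `(1 - kβ²)⁻¹ ≤ (1 - 2kβ²)^{-1/2}`, and `J_k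
x = g ∘ x` (`isJSol_iff`). The chain rule `comp_mem_gradientGraph` gives the same constant for
gradients, hence for `‖·‖₁`.

As `f_k = k⁻¹ (I - J_k)`, Cauchy-Schwarz and the bound on `J_k` give one-sided estimates in both
scalar products with constant `β² / (1 - kβ²) ≤ b`. They pass to `F_k` because `R_ε` is symmetric
and nonexpansive for both products (`HasYosidaProperties.resolventA_conj`). The two-step-size
identity is this symmetry plus bilinearity. -/

theorem gradient_add' {φ ψ : Space d → ℝ} {ξ : Space d} (hφ : DifferentiableAt ℝ φ ξ)
    (hψ : DifferentiableAt ℝ ψ ξ) :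
    gradient (fun ξ => φ ξ + ψ ξ) ξ = gradient φ ξ + gradient ψ ξ := by
  simp only [gradient, fderiv_fun_add hφ hψ, map_add]

theorem gradient_const_mul {φ : Space d → ℝ} {ξ : Space d} (c : ℝ)
    (hφ : DifferentiableAt ℝ φ ξ) :
    gradient (fun ξ => c * φ ξ) ξ = c • gradient φ ξ := by
  simp only [gradient, fderiv_const_mul hφ, map_smulₛₗ, RCLike.conj_to_real]

theorem gradient_comp_of_hasDerivAt {g : ℝ → ℝ} {c : ℝ} {φ : Space d → ℝ} {ξ : Space d}
    (hg : HasDerivAt g c (φ ξ)) (hφ : DifferentiableAt ℝ φ ξ) :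
    gradient (fun ξ => g (φ ξ)) ξ = c • gradient φ ξ := by
  have h : HasFDerivAt (fun ξ => g (φ ξ)) (c • fderiv ℝ φ ξ) ξ :=
    hg.comp_hasFDerivAt ξ hφ.hasFDerivAt
  simp only [gradient, h.fderiv, map_smulₛₗ, RCLike.conj_to_real]

theorem inner_gradient (φ : Space d → ℝ) (ξ v : Space d) :
    inner ℝ v (gradient φ ξ) = fderiv ℝ φ ξ v := by
  rw [real_inner_comm, gradient, InnerProductSpace.toDual_symm_apply]

namespace IsTestFunction

variable {φ ψ : Space d → ℝ}

theorem differentiable (h : IsTestFunction D φ) : Differentiable ℝ φ :=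
  h.1.differentiable (by simp)

theorem continuous_gradient (h : IsTestFunction D φ) : Continuous (gradient φ) :=
  (InnerProductSpace.toDual ℝ (Space d)).symm.continuous.comp (h.1.continuous_fderiv (by simp))

theorem hasCompactSupport_gradient (h : IsTestFunction D φ) : HasCompactSupport (gradient φ) :=
  (h.2.1.fderiv (𝕜 := ℝ)).comp_left (map_zero (InnerProductSpace.toDual ℝ (Space d)).symm)

theorem eq_zero (h : IsTestFunction D φ) {ξ : Space d} (hξ : ξ ∉ D) : φ ξ = 0 := by
  by_contra h0
  exact hξ (h.2.2 (subset_tsupport _ (Function.mem_support.2 h0)))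

theorem memLp (h : IsTestFunction D φ) : MemLp φ 2 (volume.restrict D) :=
  (h.1.continuous.memLp_of_hasCompactSupport h.2.1).restrict D

theorem memLp_gradient (h : IsTestFunction D φ) : MemLp (gradient φ) 2 (volume.restrict D) :=
  (h.continuous_gradient.memLp_of_hasCompactSupport h.hasCompactSupport_gradient).restrict D

theorem zero : IsTestFunction D (fun _ => 0) :=
  ⟨contDiff_const, HasCompactSupport.zero, by simp [tsupport]⟩

theorem add (hφ : IsTestFunction D φ) (hψ : IsTestFunction D ψ) :
    IsTestFunction D (fun ξ => φ ξ + ψ ξ) :=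
  ⟨hφ.1.add hψ.1, hφ.2.1.add hψ.2.1,
    (tsupport_add φ ψ).trans (Set.union_subset hφ.2.2 hψ.2.2)⟩

theorem comp {g : ℝ → ℝ} (hg : ContDiff ℝ ∞ g) (hg0 : g 0 = 0) (hφ : IsTestFunction D φ) :
    IsTestFunction D (fun ξ => g (φ ξ)) :=
  ⟨hg.comp hφ.1, hφ.2.1.comp_left hg0,
    (closure_mono (Function.support_comp_subset hg0 φ)).trans hφ.2.2⟩

theorem const_mul (c : ℝ) (hφ : IsTestFunction D φ) : IsTestFunction D (fun ξ => c * φ ξ) :=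
  hφ.comp (g := fun s => c * s) (contDiff_const.mul contDiff_id) (mul_zero c)

theorem integral_mul_inner_gradient (hφ : IsTestFunction D φ) (hψ : IsTestFunction D ψ)
    (v : Space d) :
    ∫ ξ in D, φ ξ * inner ℝ v (gradient ψ ξ) = - ∫ ξ in D, ψ ξ * inner ℝ v (gradient φ ξ) := by
  -- Test functions vanish off `D`, so the integrals extend to the whole space, where integration by
  -- parts has no boundary term and needs no regularity of `∂D`.
  rw [setIntegral_eq_integral_of_forall_compl_eq_zero
      (fun ξ hξ => by rw [hφ.eq_zero hξ, zero_mul]),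
    setIntegral_eq_integral_of_forall_compl_eq_zero
      (fun ξ hξ => by rw [hψ.eq_zero hξ, zero_mul])]
  simp only [inner_gradient]
  have hc : ∀ {χ : Space d → ℝ}, IsTestFunction D χ → Continuous fun ξ => fderiv ℝ χ ξ v :=
    fun hχ => (hχ.1.continuous_fderiv (by simp)).clm_apply continuous_const
  rw [integral_mul_fderiv_eq_neg_fderiv_mul_of_integrable]
  · simp only [mul_comm]
  · exact ((hc hφ).mul hψ.1.continuous).integrable_of_hasCompactSupport hψ.2.1.mul_left
  · exact (hφ.1.continuous.mul (hc hψ)).integrable_of_hasCompactSupport hφ.2.1.mul_right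
  · exact (hφ.1.continuous.mul hψ.1.continuous).integrable_of_hasCompactSupport hφ.2.1.mul_right
  · exact fun ξ _ => hφ.differentiable ξ
  · exact fun ξ _ => hψ.differentiable ξ

end IsTestFunction

/-! ### The graph of the gradient -/

/-- The pairs `(φ, ∇φ)` of test functions and their gradients. -/
def testPairs (D : Set (Space d)) : Submodule ℝ (L2 D × L2Vec D) where
  carrier := {p | ∃ φ, IsTestFunction D φ ∧ p.1 =ᵐ[volume.restrict D] φ ∧
    p.2 =ᵐ[volume.restrict D] gradient φ}
  zero_mem' := ⟨fun _ => 0, IsTestFunction.zero, Lp.coeFn_zero _ _ _, by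
    filter_upwards [Lp.coeFn_zero (Space d) 2 (volume.restrict D)] with ξ h
    rw [Prod.snd_zero, h]
    simp [gradient]⟩
  add_mem' := by
    rintro p q ⟨φ, hφ, h1, h2⟩ ⟨ψ, hψ, h3, h4⟩
    refine ⟨_, hφ.add hψ, ?_, ?_⟩
    · filter_upwards [Lp.coeFn_add p.1 q.1, h1, h3] with ξ h h1 h3
      rw [Prod.fst_add, h, Pi.add_apply, h1, h3]
    · filter_upwards [Lp.coeFn_add p.2 q.2, h2, h4] with ξ h h1 h3
      rw [Prod.snd_add, h, Pi.add_apply, h1, h3,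
        gradient_add' (hφ.differentiable ξ) (hψ.differentiable ξ)]
  smul_mem' := by
    rintro c p ⟨φ, hφ, h1, h2⟩
    refine ⟨_, hφ.const_mul c, ?_, ?_⟩
    · filter_upwards [Lp.coeFn_smul c p.1, h1] with ξ h h1
      rw [Prod.smul_fst, h, Pi.smul_apply, h1, smul_eq_mul]
    · filter_upwards [Lp.coeFn_smul c p.2, h2] with ξ h h1
      rw [Prod.smul_snd, h, Pi.smul_apply, h1, gradient_const_mul c (hφ.differentiable ξ)]

/-- The graph of the gradient on `H¹₀(D)`. -/
def gradientGraph (D : Set (Space d)) : Submodule ℝ (L2 D × L2Vec D) :=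
  (testPairs D).topologicalClosure

theorem mem_gradientGraph_iff {u : L2 D} {G : L2Vec D} :
    (u, G) ∈ gradientGraph D ↔
      ∀ ε : ℝ≥0∞, 0 < ε → ∃ φ : Space d → ℝ, IsTestFunction D φ ∧
        eLpNorm (fun ξ => u ξ - φ ξ) 2 (volume.restrict D) < ε ∧
        eLpNorm (fun ξ => G ξ - gradient φ ξ) 2 (volume.restrict D) < ε := by
  rw [gradientGraph, ← SetLike.mem_coe, Submodule.topologicalClosure_coe, EMetric.mem_closure_iff]
  refine forall₂_congr fun ε _ => ?_
  constructor
  · rintro ⟨⟨v, F⟩, ⟨φ, hφ, h1, h2⟩, h⟩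
    rw [Prod.edist_eq, max_lt_iff, Lp.edist_def, Lp.edist_def] at h
    refine ⟨φ, hφ, ?_, ?_⟩
    · rw [eLpNorm_congr_ae (g := ⇑u - ⇑v)]
      · exact h.1
      · filter_upwards [h1] with ξ h1
        rw [Pi.sub_apply, ← h1]
    · rw [eLpNorm_congr_ae (g := ⇑G - ⇑F)]
      · exact h.2
      · filter_upwards [h2] with ξ h1
        rw [Pi.sub_apply, ← h1]
  · rintro ⟨φ, hφ, h1, h2⟩
    refine ⟨(hφ.memLp.toLp φ, hφ.memLp_gradient.toLp (gradient φ)),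
      ⟨φ, hφ, hφ.memLp.coeFn_toLp, hφ.memLp_gradient.coeFn_toLp⟩, ?_⟩
    rw [Prod.edist_eq, max_lt_iff, Lp.edist_def, Lp.edist_def]
    constructor
    · rwa [eLpNorm_congr_ae (g := fun ξ => u ξ - φ ξ)]
      filter_upwards [hφ.memLp.coeFn_toLp] with ξ h
      rw [Pi.sub_apply, h]
    · rwa [eLpNorm_congr_ae (g := fun ξ => G ξ - gradient φ ξ)]
      filter_upwards [hφ.memLp_gradient.coeFn_toLp] with ξ h
      rw [Pi.sub_apply, h]

theorem integral_mul_eq_inner {φ : Space d → ℝ} (hφ : MemLp φ 2 (volume.restrict D)) (u : L2 D) :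
    ∫ ξ in D, u ξ * φ ξ = inner ℝ (hφ.toLp φ) u := by
  rw [L2.inner_def]
  refine integral_congr_ae ?_
  filter_upwards [hφ.coeFn_toLp] with ξ h
  rw [h]
  rfl

theorem integral_inner_eq_inner {Φ : Space d → Space d} (hΦ : MemLp Φ 2 (volume.restrict D))
    (G : L2Vec D) : ∫ ξ in D, inner ℝ (Φ ξ) (G ξ) = inner ℝ (hΦ.toLp Φ) G := by
  rw [L2.inner_def]
  refine integral_congr_ae ?_
  filter_upwards [hΦ.coeFn_toLp] with ξ h
  rw [h]

/-- For fixed `ψ` and `v` both sides are continuous in `(u, G)`, so the identity for test functions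
passes to the closure. -/
theorem integral_mul_inner_gradient_of_mem {u : L2 D} {G : L2Vec D}
    (h : (u, G) ∈ gradientGraph D) {ψ : Space d → ℝ} (hψ : IsTestFunction D ψ) (v : Space d) :
    ∫ ξ in D, u ξ * inner ℝ v (gradient ψ ξ) = - ∫ ξ in D, inner ℝ (ψ ξ • v) (G ξ) := by
  have h1 : MemLp (fun ξ => inner ℝ v (gradient ψ ξ)) 2 (volume.restrict D) :=
    hψ.memLp_gradient.const_inner v
  have h2 : MemLp (fun ξ => ψ ξ • v) 2 (volume.restrict D) := by
    refine (hψ.memLp.norm.const_mul ‖v‖).mono'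
      (hψ.memLp.aestronglyMeasurable.smul aestronglyMeasurable_const) (ae_of_all _ fun ξ => ?_)
    rw [norm_smul, mul_comm]
  rw [integral_mul_eq_inner h1, integral_inner_eq_inner h2]
  have hcl : IsClosed {p : L2 D × L2Vec D |
      inner ℝ (h1.toLp _) p.1 = - inner ℝ (h2.toLp _) p.2} :=
    isClosed_eq (continuous_const.inner continuous_fst) (continuous_const.inner continuous_snd).neg
  refine closure_minimal ?_ hcl h
  rintro ⟨w, F⟩ ⟨φ, hφ, h3, h4⟩
  change inner ℝ (h1.toLp _) w = - inner ℝ (h2.toLp _) F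
  rw [← integral_mul_eq_inner h1, ← integral_inner_eq_inner h2]
  have e1 : ∫ ξ in D, w ξ * inner ℝ v (gradient ψ ξ) =
      ∫ ξ in D, φ ξ * inner ℝ v (gradient ψ ξ) := by
    refine integral_congr_ae ?_
    filter_upwards [h3] with ξ h
    rw [← h]
  have e2 : ∫ ξ in D, inner ℝ (ψ ξ • v) (F ξ) = ∫ ξ in D, ψ ξ * inner ℝ v (gradient φ ξ) := by
    refine integral_congr_ae ?_
    filter_upwards [h4] with ξ h
    rw [← h, real_inner_smul_left]
  rw [e1, e2, hφ.integral_mul_inner_gradient hψ]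

theorem hasWeakGradient_of_mem {u : L2 D} {G : L2Vec D} (h : (u, G) ∈ gradientGraph D) :
    HasWeakGradient D u G := by
  intro ψ hψ
  have i1 : Integrable (fun ξ => u ξ • gradient ψ ξ) (volume.restrict D) :=
    memLp_one_iff_integrable.1 (hψ.memLp_gradient.smul (Lp.memLp u))
  have i2 : Integrable (fun ξ => ψ ξ • G ξ) (volume.restrict D) :=
    memLp_one_iff_integrable.1 ((Lp.memLp G).smul hψ.memLp)
  refine ext_inner_left ℝ fun v => ?_
  rw [inner_neg_right, ← integral_inner i1, ← integral_inner i2]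
  simpa only [real_inner_smul_left, real_inner_smul_right] using
    integral_mul_inner_gradient_of_mem h hψ v

/-- The fundamental lemma of the calculus of variations applied to `G - F`, which is locally
integrable on the open set `D`. This is what makes the choice in `weakGrad` harmless. -/
theorem HasWeakGradient.unique (hD : IsOpen D) {u : L2 D} {G F : L2Vec D}
    (hG : HasWeakGradient D u G) (hF : HasWeakGradient D u F) : G = F := by
  have hint : ∀ G : L2Vec D, LocallyIntegrableOn G D volume := fun G => by
    rw [locallyIntegrableOn_iff hD.isLocallyClosed]
    intro K hKD hK
    have hm : MemLp G 2 (volume.restrict K) :=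
      (Lp.memLp G).mono_measure (Measure.restrict_mono hKD le_rfl)
    have : IsFiniteMeasure (volume.restrict K) := ⟨by simpa using hK.measure_lt_top⟩
    exact hm.integrable (by norm_num)
  have key := hD.ae_eq_zero_of_integral_contDiff_smul_eq_zero ((hint G).sub (hint F)) (by
    intro ψ h1 h2 h3
    have hψ : IsTestFunction D ψ := ⟨h1, h2, h3⟩
    rw [← setIntegral_eq_integral_of_forall_compl_eq_zero (s := D)
      (fun ξ hξ => by rw [hψ.eq_zero hξ, zero_smul])]
    have i : ∀ G : L2Vec D, Integrable (fun ξ => ψ ξ • G ξ) (volume.restrict D) :=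
      fun G => memLp_one_iff_integrable.1 ((Lp.memLp G).smul hψ.memLp)
    simp only [Pi.sub_apply, smul_sub]
    rw [integral_sub (i G) (i F), sub_eq_zero, ← neg_inj, ← hG ψ hψ, ← hF ψ hψ])
  refine Lp.ext ((ae_restrict_iff' hD.measurableSet).2 ?_)
  filter_upwards [key] with ξ h hξ
  exact sub_eq_zero.1 (h hξ)

/-- Approximability by test functions already forces `G` to be the weak gradient, so only membership
in the closure has to be tracked. -/
theorem memH10_iff {u : L2 D} : MemH10 D u ↔ ∃ G, (u, G) ∈ gradientGraph D :=
  ⟨fun ⟨G, _, h⟩ => ⟨G, mem_gradientGraph_iff.2 h⟩,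
    fun ⟨G, h⟩ => ⟨G, hasWeakGradient_of_mem h, mem_gradientGraph_iff.1 h⟩⟩

theorem weakGrad_eq (hD : IsOpen D) {u : L2 D} {G : L2Vec D} (h : (u, G) ∈ gradientGraph D) :
    weakGrad D u = G := by
  have hex : ∃ G : L2Vec D, HasWeakGradient D u G := ⟨G, hasWeakGradient_of_mem h⟩
  rw [weakGrad, dif_pos hex]
  exact hex.choose_spec.unique hD (hasWeakGradient_of_mem h)

theorem MemH10.mem_gradientGraph (hD : IsOpen D) {u : L2 D} (h : MemH10 D u) :
    (u, weakGrad D u) ∈ gradientGraph D := by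
  obtain ⟨G, hG⟩ := memH10_iff.1 h
  rwa [weakGrad_eq hD hG]

theorem MemH10.smul (c : ℝ) {u : L2 D} (hu : MemH10 D u) : MemH10 D (c • u) := by
  obtain ⟨G, hG⟩ := memH10_iff.1 hu
  exact memH10_iff.2 ⟨c • G, Submodule.smul_mem _ c hG⟩

theorem MemH10.sub {u v : L2 D} (hu : MemH10 D u) (hv : MemH10 D v) : MemH10 D (u - v) := by
  obtain ⟨G, hG⟩ := memH10_iff.1 hu
  obtain ⟨F, hF⟩ := memH10_iff.1 hv
  exact memH10_iff.2 ⟨G - F, sub_mem hG hF⟩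

theorem weakGrad_sub (hD : IsOpen D) {u v : L2 D} (hu : MemH10 D u) (hv : MemH10 D v) :
    weakGrad D (u - v) = weakGrad D u - weakGrad D v :=
  weakGrad_eq hD (sub_mem (hu.mem_gradientGraph hD) (hv.mem_gradientGraph hD))

theorem weakGrad_smul (hD : IsOpen D) (c : ℝ) {u : L2 D} (hu : MemH10 D u) :
    weakGrad D (c • u) = c • weakGrad D u :=
  weakGrad_eq hD (Submodule.smul_mem _ c (hu.mem_gradientGraph hD))

/-! ### The chain rule in `H¹₀(D)` -/

theorem tendsto_L2_of_dominated {α E : Type*} [MeasurableSpace α] {μ : Measure α}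
    [NormedAddCommGroup E] [InnerProductSpace ℝ E] {V : ℕ → Lp E 2 μ} {W B : Lp E 2 μ} {C : ℝ}
    (hB : ∀ n, ∀ᵐ ξ ∂μ, ‖V n ξ‖ ≤ C * ‖B ξ‖)
    (hlim : ∀ᵐ ξ ∂μ, Tendsto (fun n => V n ξ) atTop (𝓝 (W ξ))) :
    Tendsto V atTop (𝓝 W) := by
  have hnorm : ∀ f : Lp E 2 μ, ‖f‖ ^ 2 = ∫ ξ, ‖f ξ‖ ^ 2 ∂μ := fun f => by
    rw [← real_inner_self_eq_norm_sq, L2.inner_def]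
    simp only [real_inner_self_eq_norm_sq]
  have hW : ∀ᵐ ξ ∂μ, ‖W ξ‖ ≤ C * ‖B ξ‖ := by
    filter_upwards [ae_all_iff.2 hB, hlim] with ξ h1 h2
    exact le_of_tendsto h2.norm (Eventually.of_forall h1)
  have key : Tendsto (fun n => ∫ ξ, ‖(V n - W) ξ‖ ^ 2 ∂μ) atTop (𝓝 (∫ _, (0 : ℝ) ∂μ)) := by
    refine tendsto_integral_of_dominated_convergence (fun ξ => (2 * C) ^ 2 * ‖B ξ‖ ^ 2)
      (fun n => ((Lp.memLp _).aestronglyMeasurable.norm.pow 2))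
      (((Lp.memLp B).integrable_norm_pow (by norm_num)).const_mul _) (fun n => ?_) ?_
    · filter_upwards [hB n, hW, Lp.coeFn_sub (V n) W] with ξ h1 h2 h3
      rw [h3, Pi.sub_apply, norm_pow, norm_norm, ← mul_pow]
      refine pow_le_pow_left₀ (norm_nonneg _) ?_ 2
      linarith [norm_sub_le (V n ξ) (W ξ)]
    · filter_upwards [ae_all_iff.2 fun n => Lp.coeFn_sub (V n) W, hlim] with ξ h1 h2
      have h3 : Tendsto (fun n => ‖V n ξ - W ξ‖ ^ 2) atTop (𝓝 (‖W ξ - W ξ‖ ^ 2)) :=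
        (h2.sub_const _).norm.pow 2
      simp only [h1, Pi.sub_apply]
      simpa using h3
  rw [integral_zero] at key
  rw [tendsto_iff_norm_sub_tendsto_zero]
  have h2 := (Real.continuous_sqrt.tendsto 0).comp key
  simp only [Function.comp_def, ← hnorm, Real.sqrt_sq (norm_nonneg _), Real.sqrt_zero] at h2
  exact h2

/-- If test functions `φₙ` approximate `u`, then `g ∘ φₙ` are again test functions because `g` is
smooth with `g 0 = 0`, and they converge since `g` is Lipschitz. For the gradients, `g'(φₙ) ∇φₙ` is
compared with `g'(φₙ) G`: the difference is at most `L ‖∇φₙ - G‖`, and `g'(φₙ) G → g'(u) G` by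
dominated convergence along an a.e. convergent subsequence. -/
theorem comp_mem_gradientGraph {g g' : ℝ → ℝ} {L : ℝ} (hg : ContDiff ℝ ∞ g) (hg0 : g 0 = 0)
    (hg' : ∀ s, HasDerivAt g (g' s) s) (hL : ∀ s, |g' s| ≤ L) {u w : L2 D} {G W : L2Vec D}
    (hu : (u, G) ∈ gradientGraph D) (hw : w =ᵐ[volume.restrict D] fun ξ => g (u ξ))
    (hW : W =ᵐ[volume.restrict D] fun ξ => g' (u ξ) • G ξ) : (w, W) ∈ gradientGraph D := by
  have hcont : Continuous g' := by
    have : g' = deriv g := funext fun s => (hg' s).deriv.symm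
    rw [this]
    exact hg.continuous_deriv (by simp)
  have hlip : ∀ s t, ‖g s - g t‖ ≤ L * ‖s - t‖ := fun s t =>
    Convex.norm_image_sub_le_of_norm_hasDerivWithin_le (s := Set.univ)
      (fun x _ => (hg' x).hasDerivWithinAt) (fun x _ => hL x) convex_univ trivial trivial
  obtain ⟨p, hp, hlim⟩ := mem_closure_iff_seq_limit.1 hu
  obtain ⟨hlim1, hlim2⟩ := (Prod.tendsto_iff _ _).1 hlim
  obtain ⟨ns, hns, hae⟩ := (tendstoInMeasure_of_tendsto_Lp hlim1).exists_seq_tendsto_ae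
  choose φ hφ h1 h2 using fun n => hp (ns n)
  have hm : ∀ n (F : L2Vec D),
      MemLp (fun ξ => g' (φ n ξ) • F ξ) 2 (volume.restrict D) := fun n F => by
    refine ((Lp.memLp F).norm.const_mul L).mono'
      ((hcont.comp (hφ n).1.continuous).aestronglyMeasurable.smul
        (Lp.memLp F).aestronglyMeasurable) (ae_of_all _ fun ξ => ?_)
    rw [norm_smul]
    exact mul_le_mul_of_nonneg_right (hL _) (norm_nonneg _)
  have hcφ : ∀ n, IsTestFunction D (fun ξ => g (φ n ξ)) := fun n => (hφ n).comp hg hg0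
  set a : ℕ → L2 D := fun n => (hcφ n).memLp.toLp _
  set b : ℕ → L2Vec D := fun n => (hm n (p (ns n)).2).toLp _
  set V : ℕ → L2Vec D := fun n => (hm n G).toLp _
  have ha' : ∀ n, a n =ᵐ[volume.restrict D] fun ξ => g (φ n ξ) :=
    fun n => (hcφ n).memLp.coeFn_toLp
  have hb' : ∀ n, b n =ᵐ[volume.restrict D] fun ξ => g' (φ n ξ) • (p (ns n)).2 ξ :=
    fun n => (hm n (p (ns n)).2).coeFn_toLp
  have hV' : ∀ n, V n =ᵐ[volume.restrict D] fun ξ => g' (φ n ξ) • G ξ :=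
    fun n => (hm n G).coeFn_toLp
  have hmem : ∀ n, (a n, b n) ∈ testPairs D := fun n => by
    refine ⟨_, hcφ n, ha' n, ?_⟩
    filter_upwards [hb' n, h2 n] with ξ h3 h4
    rw [h3, h4, gradient_comp_of_hasDerivAt (hg' _) ((hφ n).differentiable ξ)]
  have hlima : Tendsto a atTop (𝓝 w) := by
    rw [tendsto_iff_norm_sub_tendsto_zero]
    have h0 : Tendsto (fun n => L * ‖(p (ns n)).1 - u‖) atTop (𝓝 (L * 0)) :=
      ((tendsto_iff_norm_sub_tendsto_zero.1 hlim1).comp hns.tendsto_atTop).const_mul L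
    rw [mul_zero] at h0
    refine squeeze_zero (fun _ => norm_nonneg _) (fun n => ?_) h0
    refine Lp.norm_le_mul_norm_of_ae_le_mul ?_
    filter_upwards [Lp.coeFn_sub (a n) w, Lp.coeFn_sub (p (ns n)).1 u, ha' n, hw, h1 n]
      with ξ h3 h4 h5 h6 h7
    rw [h3, h4, Pi.sub_apply, Pi.sub_apply, h5, h6, h7]
    exact hlip _ _
  have hlimV : Tendsto V atTop (𝓝 W) := by
    refine tendsto_L2_of_dominated (C := L) (B := G) (fun n => ?_) ?_
    · filter_upwards [hV' n] with ξ h3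
      rw [h3, norm_smul]
      exact mul_le_mul_of_nonneg_right (hL _) (norm_nonneg _)
    · filter_upwards [ae_all_iff.2 hV', hW, hae, ae_all_iff.2 h1] with ξ h3 h4 h5 h6
      simp only [h3, h4]
      simp only [h6] at h5
      exact ((hcont.tendsto _).comp h5).smul_const _
  have hlimb : Tendsto b atTop (𝓝 W) := by
    have h0 : Tendsto (fun n => L * ‖(p (ns n)).2 - G‖) atTop (𝓝 (L * 0)) :=
      ((tendsto_iff_norm_sub_tendsto_zero.1 hlim2).comp hns.tendsto_atTop).const_mul L
    rw [mul_zero] at h0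
    have h1 : Tendsto (fun n => b n - V n) atTop (𝓝 0) := by
      rw [tendsto_zero_iff_norm_tendsto_zero]
      refine squeeze_zero (fun _ => norm_nonneg _) (fun n => ?_) h0
      refine Lp.norm_le_mul_norm_of_ae_le_mul ?_
      filter_upwards [Lp.coeFn_sub (b n) (V n), Lp.coeFn_sub (p (ns n)).2 G, hb' n, hV' n]
        with ξ h3 h4 h5 h6
      rw [h3, h4, Pi.sub_apply, Pi.sub_apply, h5, h6, ← smul_sub, norm_smul]
      exact mul_le_mul_of_nonneg_right (hL _) (norm_nonneg _)
    simpa using h1.add hlimV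
  exact mem_closure_of_tendsto (hlima.prodMk_nhds hlimb) (Eventually.of_forall hmem)

/-! ### The energy space -/

/-- `κ` is a measurable coefficient on `D` bounded above and away from zero. -/
structure IsWeight (D : Set (Space d)) (κ : Space d → ℝ) : Prop where
  aestronglyMeasurable : AEStronglyMeasurable κ (volume.restrict D)
  lower : ∃ c, 0 < c ∧ ∀ᵐ ξ ∂volume.restrict D, c ≤ κ ξ
  upper : ∃ C, ∀ᵐ ξ ∂volume.restrict D, κ ξ ≤ C

theorem IsWeight.const_mul {κ : Space d → ℝ} (hκ : IsWeight D κ) {ε : ℝ} (hε : 0 < ε) :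
    IsWeight D (fun ξ => ε * κ ξ) where
  aestronglyMeasurable := hκ.aestronglyMeasurable.const_mul ε
  lower := by
    obtain ⟨c, hc, h⟩ := hκ.lower
    exact ⟨ε * c, mul_pos hε hc, h.mono fun ξ h => mul_le_mul_of_nonneg_left h hε.le⟩
  upper := by
    obtain ⟨C, h⟩ := hκ.upper
    exact ⟨ε * C, h.mono fun ξ h => mul_le_mul_of_nonneg_left h hε.le⟩

theorem exists_mul_clm {ρ : Space d → ℝ} (hρ : AEStronglyMeasurable ρ (volume.restrict D)) {C : ℝ}
    (hC : ∀ᵐ ξ ∂volume.restrict D, |ρ ξ| ≤ C) :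
    ∃ M : L2Vec D →L[ℝ] L2Vec D, ∀ G, M G =ᵐ[volume.restrict D] fun ξ => ρ ξ • G ξ := by
  have hbd : ∀ G : L2Vec D, ∀ᵐ ξ ∂volume.restrict D, ‖ρ ξ • G ξ‖ ≤ C * ‖G ξ‖ := fun G => by
    filter_upwards [hC] with ξ h
    rw [norm_smul]
    exact mul_le_mul_of_nonneg_right h (norm_nonneg _)
  have hm : ∀ G : L2Vec D, MemLp (fun ξ => ρ ξ • G ξ) 2 (volume.restrict D) := fun G =>
    ((Lp.memLp G).norm.const_mul C).mono' (hρ.smul (Lp.memLp G).aestronglyMeasurable) (hbd G)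
  let T : L2Vec D →ₗ[ℝ] L2Vec D :=
    { toFun := fun G => (hm G).toLp _
      map_add' := fun G F => by
        refine Lp.ext ?_
        filter_upwards [(hm (G + F)).coeFn_toLp, (hm G).coeFn_toLp, (hm F).coeFn_toLp,
          Lp.coeFn_add G F, Lp.coeFn_add ((hm G).toLp _) ((hm F).toLp _)] with ξ h1 h2 h3 h4 h5
        rw [h1, h5, Pi.add_apply, h2, h3, h4, Pi.add_apply, smul_add]
      map_smul' := fun c G => by
        refine Lp.ext ?_
        filter_upwards [(hm (c • G)).coeFn_toLp, (hm G).coeFn_toLp,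
          Lp.coeFn_smul c G, Lp.coeFn_smul c ((hm G).toLp _)] with ξ h1 h2 h4 h5
        rw [h1, RingHom.id_apply, h5, Pi.smul_apply, h2, h4, Pi.smul_apply, smul_comm] }
  refine ⟨T.mkContinuous C fun G => ?_, fun G => (hm G).coeFn_toLp⟩
  refine Lp.norm_le_mul_norm_of_ae_le_mul ?_
  filter_upwards [(hm G).coeFn_toLp, hbd G] with ξ h1 h2
  change ‖(hm G).toLp _ ξ‖ ≤ _
  rw [h1]
  exact h2

/-- Multiplication by `√κ` is an automorphism of `L₂(D; ℝᵈ)`. -/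
theorem IsWeight.exists_sqrt_mul {κ : Space d → ℝ} (hκ : IsWeight D κ) :
    ∃ M : L2Vec D ≃L[ℝ] L2Vec D,
      ∀ G, M G =ᵐ[volume.restrict D] fun ξ => Real.sqrt (κ ξ) • G ξ := by
  obtain ⟨c, hc, hlow⟩ := hκ.lower
  obtain ⟨C, hup⟩ := hκ.upper
  have hm : AEStronglyMeasurable (fun ξ => Real.sqrt (κ ξ)) (volume.restrict D) :=
    Real.continuous_sqrt.comp_aestronglyMeasurable hκ.aestronglyMeasurable
  obtain ⟨M, hM⟩ := exists_mul_clm hm (C := Real.sqrt C) (by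
    filter_upwards [hup] with ξ h
    rw [abs_of_nonneg (Real.sqrt_nonneg _)]
    exact Real.sqrt_le_sqrt h)
  obtain ⟨N, hN⟩ := exists_mul_clm (ρ := fun ξ => (Real.sqrt (κ ξ))⁻¹) (D := D)
    (hm.aemeasurable.inv.aestronglyMeasurable) (C := (Real.sqrt c)⁻¹) (by
      filter_upwards [hlow] with ξ h
      rw [abs_of_nonneg (inv_nonneg.2 (Real.sqrt_nonneg _))]
      exact inv_anti₀ (Real.sqrt_pos.2 hc) (Real.sqrt_le_sqrt h))
  have hpos : ∀ᵐ ξ ∂volume.restrict D, Real.sqrt (κ ξ) ≠ 0 :=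
    hlow.mono fun ξ h => (Real.sqrt_pos.2 (hc.trans_le h)).ne'
  refine ⟨ContinuousLinearEquiv.equivOfInverse M N (fun G => Lp.ext ?_) (fun G => Lp.ext ?_), hM⟩
  · filter_upwards [hN (M G), hM G, hpos] with ξ h1 h2 h3
    rw [h1, h2, inv_smul_smul₀ h3]
  · filter_upwards [hM (N G), hN G, hpos] with ξ h1 h2 h3
    rw [h1, h2, smul_inv_smul₀ h3]

/-- As the pullback of a scalar product, the form inherits positivity, Cauchy-Schwarz and linearity
without separate integrability arguments. -/
theorem form_eq_inner {κ : Space d → ℝ} (hκ : IsWeight D κ) {M : L2Vec D ≃L[ℝ] L2Vec D}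
    (hM : ∀ G, M G =ᵐ[volume.restrict D] fun ξ => Real.sqrt (κ ξ) • G ξ) (u v : L2 D) :
    form D κ u v = inner ℝ (M (weakGrad D u)) (M (weakGrad D v)) := by
  obtain ⟨c, hc, hlow⟩ := hκ.lower
  rw [form, L2.inner_def]
  refine integral_congr_ae ?_
  filter_upwards [hM (weakGrad D u), hM (weakGrad D v), hlow] with ξ h1 h2 h3
  rw [h1, h2, real_inner_smul_left, real_inner_smul_right, ← mul_assoc,
    Real.mul_self_sqrt (hc.le.trans h3)]

theorem form_comm (κ : Space d → ℝ) (u v : L2 D) : form D κ u v = form D κ v u := by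
  simp only [form, real_inner_comm]

theorem form_const_mul (κ : Space d → ℝ) (ε : ℝ) (u v : L2 D) :
    form D (fun ξ => ε * κ ξ) u v = ε * form D κ u v := by
  simp only [form, mul_assoc, integral_const_mul]

variable {κ : Space d → ℝ}

theorem form_self_nonneg (hκ : IsWeight D κ) (u : L2 D) : 0 ≤ form D κ u u := by
  obtain ⟨M, hM⟩ := hκ.exists_sqrt_mul
  rw [form_eq_inner hκ hM]
  exact real_inner_self_nonneg

theorem norm1_sq (hκ : IsWeight D κ) (u : L2 D) : norm1 D κ u ^ 2 = form D κ u u :=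
  Real.sq_sqrt (form_self_nonneg hκ u)

theorem form_le_norm1_mul (hκ : IsWeight D κ) (u v : L2 D) : form D κ u v ≤ norm1 D κ u * norm1 D κ v := by
  obtain ⟨M, hM⟩ := hκ.exists_sqrt_mul
  simp only [norm1, form_eq_inner hκ hM, ← norm_eq_sqrt_real_inner]
  exact real_inner_le_norm _ _

theorem form_sub_left (hκ : IsWeight D κ) (hD : IsOpen D) {u v : L2 D} (hu : MemH10 D u) (hv : MemH10 D v)
    (w : L2 D) : form D κ (u - v) w = form D κ u w - form D κ v w := by
  obtain ⟨M, hM⟩ := hκ.exists_sqrt_mul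
  simp only [form_eq_inner hκ hM, weakGrad_sub hD hu hv, map_sub, inner_sub_left]

theorem form_sub_right (hκ : IsWeight D κ) (hD : IsOpen D) {u v : L2 D} (hu : MemH10 D u) (hv : MemH10 D v)
    (w : L2 D) : form D κ w (u - v) = form D κ w u - form D κ w v := by
  rw [form_comm, form_sub_left hκ hD hu hv, form_comm, form_comm κ v]

theorem form_smul_left (hκ : IsWeight D κ) (hD : IsOpen D) (c : ℝ) {u : L2 D} (hu : MemH10 D u) (w : L2 D) :
    form D κ (c • u) w = c * form D κ u w := by
  obtain ⟨M, hM⟩ := hκ.exists_sqrt_mul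
  simp only [form_eq_inner hκ hM, weakGrad_smul hD c hu, map_smul, real_inner_smul_left]

/-- The pairs `(u, M ∇u)` with `u ∈ H¹₀(D)`; if `M` is multiplication by `√κ`, their scalar product
is `⟨u, v⟩ + a(u, v)`. -/
def energySpace (M : L2Vec D ≃L[ℝ] L2Vec D) : Submodule ℝ (WithLp 2 (L2 D × L2Vec D)) :=
  (gradientGraph D).comap
    (((ContinuousLinearMap.id ℝ (L2 D)).prodMap (M.symm : L2Vec D →L[ℝ] L2Vec D)).comp
      (WithLp.prodContinuousLinearEquiv 2 ℝ (L2 D) (L2Vec D)).toContinuousLinearMap).toLinearMap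

theorem mem_energySpace {M : L2Vec D ≃L[ℝ] L2Vec D} {p : WithLp 2 (L2 D × L2Vec D)} :
    p ∈ energySpace M ↔ (p.fst, M.symm p.snd) ∈ gradientGraph D :=
  Iff.rfl

instance completeSpace_energySpace (M : L2Vec D ≃L[ℝ] L2Vec D) :
    CompleteSpace (energySpace M) := by
  have : IsClosed (energySpace M : Set (WithLp 2 (L2 D × L2Vec D))) :=
    (Submodule.isClosed_topologicalClosure (testPairs D)).preimage
      (((ContinuousLinearMap.id ℝ (L2 D)).prodMap (M.symm : L2Vec D →L[ℝ] L2Vec D)).comp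
        (WithLp.prodContinuousLinearEquiv 2 ℝ (L2 D) (L2Vec D)).toContinuousLinearMap).continuous
  exact this.completeSpace_coe

theorem memH10_fst {M : L2Vec D ≃L[ℝ] L2Vec D} (p : energySpace M) : MemH10 D p.1.fst :=
  memH10_iff.2 ⟨_, mem_energySpace.1 p.2⟩

theorem MemH10.exists_energySpace (hD : IsOpen D) (M : L2Vec D ≃L[ℝ] L2Vec D) {u : L2 D}
    (hu : MemH10 D u) : ∃ p : energySpace M, p.1.fst = u :=
  ⟨⟨WithLp.toLp 2 (u, M (weakGrad D u)), mem_energySpace.2 (by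
    simpa using hu.mem_gradientGraph hD)⟩, rfl⟩

theorem inner_energySpace (hD : IsOpen D) (hκ : IsWeight D κ) {M : L2Vec D ≃L[ℝ] L2Vec D}
    (hM : ∀ G, M G =ᵐ[volume.restrict D] fun ξ => Real.sqrt (κ ξ) • G ξ) (p q : energySpace M) :
    inner ℝ p q = inner ℝ p.1.fst q.1.fst + form D κ p.1.fst q.1.fst := by
  have h : ∀ p : energySpace M, M (weakGrad D p.1.fst) = p.1.snd := fun p => by
    rw [weakGrad_eq hD (mem_energySpace.1 p.2), M.apply_symm_apply]
  rw [form_eq_inner hκ hM, h, h]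
  rfl

/-- By uniqueness of the weak gradient the second component is a function of the first. -/
theorem energySpace_ext (hD : IsOpen D) {M : L2Vec D ≃L[ℝ] L2Vec D} {p q : energySpace M}
    (h : p.1.fst = q.1.fst) : p = q := by
  have h2 : M.symm p.1.snd = M.symm q.1.snd := by
    rw [← weakGrad_eq hD (mem_energySpace.1 p.2), ← weakGrad_eq hD (mem_energySpace.1 q.2), h]
  exact Subtype.ext (WithLp.ofLp_injective 2 (Prod.ext h (M.symm.injective h2)))

/-! ### The resolvent of the elliptic operator -/

theorem exists_isResolventSol (hD : IsOpen D) (hκ : IsWeight D κ) {ε : ℝ} (hε : 0 < ε)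
    (x : L2 D) : ∃ y, IsResolventSol D κ ε x y := by
  -- With the weight `ε κ` the energy product is exactly `⟨y, v⟩ + ε a(y, v)`, so the equation says
  -- that `y` represents the functional `⟨x, ·⟩`.
  obtain ⟨M, hM⟩ := (hκ.const_mul hε).exists_sqrt_mul
  let ℓ : energySpace M →L[ℝ] ℝ :=
    (innerSL ℝ x).comp ((WithLp.fstL 2 ℝ (L2 D) (L2Vec D)).comp (energySpace M).subtypeL)
  refine ⟨((InnerProductSpace.toDual ℝ (energySpace M)).symm ℓ).1.fst, memH10_fst _, fun v hv => ?_⟩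
  obtain ⟨p, rfl⟩ := hv.exists_energySpace hD M
  rw [← form_const_mul, ← inner_energySpace hD (hκ.const_mul hε) hM,
    InnerProductSpace.toDual_symm_apply]
  rfl

theorem IsResolventSol.unique (hD : IsOpen D) (hκ : IsWeight D κ) {ε : ℝ} (hε : 0 < ε)
    {x y z : L2 D} (hy : IsResolventSol D κ ε x y) (hz : IsResolventSol D κ ε x z) : y = z := by
  have h := (hy.2 _ (hy.1.sub hz.1)).trans (hz.2 _ (hy.1.sub hz.1)).symm
  have h1 : inner ℝ (y - z) (y - z) + ε * form D κ (y - z) (y - z) = 0 := by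
    rw [inner_sub_left, form_sub_left hκ hD hy.1 hz.1]
    linear_combination h
  have h2 := mul_nonneg hε.le (form_self_nonneg hκ (y - z))
  have h3 : inner ℝ (y - z) (y - z) = (0 : ℝ) :=
    le_antisymm (by linarith) real_inner_self_nonneg
  exact sub_eq_zero.1 (inner_self_eq_zero.1 h3)

section Resolvent

variable {ε : ℝ}

theorem isResolventSol_resolventA (hD : IsOpen D) (hκ : IsWeight D κ) (hε : 0 < ε) (x : L2 D) :
    IsResolventSol D κ ε x (resolventA D κ ε x) := by
  have h := exists_isResolventSol hD hκ hε x
  rw [resolventA, dif_pos h]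
  exact h.choose_spec

theorem resolventA_sub (hD : IsOpen D) (hκ : IsWeight D κ) (hε : 0 < ε) (x y : L2 D) :
    resolventA D κ ε (x - y) = resolventA D κ ε x - resolventA D κ ε y := by
  have hx := isResolventSol_resolventA hD hκ hε x
  have hy := isResolventSol_resolventA hD hκ hε y
  refine (isResolventSol_resolventA hD hκ hε (x - y)).unique hD hκ hε
    ⟨hx.1.sub hy.1, fun v hv => ?_⟩
  rw [inner_sub_left, inner_sub_left, form_sub_left hκ hD hx.1 hy.1]
  linear_combination hx.2 v hv - hy.2 v hv

/-- Each of the two equations is tested with the solution of the other; the left-hand sides agree by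
symmetry of the form. -/
theorem inner_resolventA_comm (hD : IsOpen D) (hκ : IsWeight D κ) (hε : 0 < ε) (x y : L2 D) :
    inner ℝ (resolventA D κ ε x) y = inner ℝ x (resolventA D κ ε y) := by
  have hx := isResolventSol_resolventA hD hκ hε x
  have hy := isResolventSol_resolventA hD hκ hε y
  have h1 := hx.2 _ hy.1
  have h2 := hy.2 _ hx.1
  rw [real_inner_comm, ← h2, ← h1, real_inner_comm, form_comm]

theorem norm_resolventA_le (hD : IsOpen D) (hκ : IsWeight D κ) (hε : 0 < ε) (x : L2 D) :
    ‖resolventA D κ ε x‖ ≤ ‖x‖ := by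
  have hx := isResolventSol_resolventA hD hκ hε x
  have h1 := hx.2 _ hx.1
  rw [real_inner_self_eq_norm_sq] at h1
  have h2 := mul_nonneg hε.le (form_self_nonneg hκ (resolventA D κ ε x))
  have h3 := real_inner_le_norm x (resolventA D κ ε x)
  by_contra! h
  nlinarith [norm_nonneg x, norm_nonneg (resolventA D κ ε x)]

/-- By the equation, `ε a(R x, y) = ⟨x, y⟩ - ⟨R x, y⟩`, which is symmetric in `x` and `y`. -/
theorem form_resolventA_comm (hD : IsOpen D) (hκ : IsWeight D κ) (hε : 0 < ε) {x y : L2 D}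
    (hx : MemH10 D x) (hy : MemH10 D y) :
    form D κ (resolventA D κ ε x) y = form D κ x (resolventA D κ ε y) := by
  have h1 := (isResolventSol_resolventA hD hκ hε x).2 _ hy
  have h2 := (isResolventSol_resolventA hD hκ hε y).2 _ hx
  rw [real_inner_comm, ← inner_resolventA_comm hD hκ hε, form_comm, real_inner_comm] at h2
  rw [real_inner_comm] at h1
  refine mul_left_cancel₀ hε.ne' ?_
  have h3 : inner ℝ y (resolventA D κ ε x) = inner ℝ (resolventA D κ ε x) y := real_inner_comm _ _
  have h4 : inner ℝ x y = inner ℝ y x := real_inner_comm _ _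
  linarith

theorem norm1_resolventA_le (hD : IsOpen D) (hκ : IsWeight D κ) (hε : 0 < ε) {x : L2 D}
    (hx : MemH10 D x) : norm1 D κ (resolventA D κ ε x) ≤ norm1 D κ x := by
  have hy := isResolventSol_resolventA hD hκ hε x
  set y := resolventA D κ ε x
  refine Real.sqrt_le_sqrt ?_
  -- Testing with `x - y` gives `ε a(y, x - y) = ‖x - y‖² ≥ 0`, that is `a(y, y) ≤ a(y, x)`. Then
  -- `a(x - y, x - y) ≥ 0` yields `a(x, x) ≥ 2 a(x, y) - a(y, y) ≥ a(y, y)`.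
  have h0 : 0 ≤ form D κ y (x - y) := by
    have h1 := hy.2 _ (hx.sub hy.1)
    have h2 : 0 ≤ inner ℝ (x - y) (x - y) := real_inner_self_nonneg
    rw [inner_sub_left] at h2
    exact le_of_mul_le_mul_left (by linarith) hε
  have h3 := form_self_nonneg hκ (x - y)
  rw [form_sub_left hκ hD hx hy.1, form_sub_right hκ hD hx hy.1] at h3
  rw [form_sub_right hκ hD hx hy.1] at h0
  rw [form_sub_right hκ hD hx hy.1] at h3
  rw [form_comm κ x y] at h3
  linarith

end Resolvent

/-! ### Expansion in eigenfunctions -/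

/-- The normalized eigenfunctions are an orthonormal basis of the energy space. -/
theorem IsEigenbasis.exists_hilbertBasis (hD : IsOpen D) (hκ : IsWeight D κ)
    {M : L2Vec D ≃L[ℝ] L2Vec D}
    (hM : ∀ G, M G =ᵐ[volume.restrict D] fun ξ => Real.sqrt (κ ξ) • G ξ)
    {lam : ℕ → ℝ} {e : HilbertBasis ℕ ℝ (L2 D)} (he : IsEigenbasis D κ lam e) :
    ∃ b : HilbertBasis ℕ ℝ (energySpace M), ∀ (n : ℕ) (p : energySpace M),
      inner ℝ (b n) p = Real.sqrt (1 + lam n) * inner ℝ (e n) p.1.fst := by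
  choose E hE using fun n => (he.mem n).exists_energySpace hD M
  have hpos : ∀ n, 0 < 1 + lam n := fun n => by linarith [he.pos n]
  have hinner : ∀ n (p : energySpace M),
      inner ℝ (E n) p = (1 + lam n) * inner ℝ (e n) p.1.fst := fun n p => by
    rw [inner_energySpace hD hκ hM, hE, he.eigen n _ (memH10_fst p)]
    ring
  -- The eigenvalue equation gives `eₙ` the squared energy norm `1 + λₙ`, hence the normalization.
  let B : ℕ → energySpace M := fun n => (Real.sqrt (1 + lam n))⁻¹ • E n
  have hB : ∀ n (p : energySpace M),
      inner ℝ (B n) p = Real.sqrt (1 + lam n) * inner ℝ (e n) p.1.fst := fun n p => by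
    have h1 : Real.sqrt (1 + lam n) ≠ 0 := (Real.sqrt_pos.2 (hpos n)).ne'
    have h2 := Real.mul_self_sqrt (hpos n).le
    refine (real_inner_smul_left (E n) p _).trans ?_
    rw [hinner, ← mul_assoc]
    congr 1
    rw [inv_mul_eq_iff_eq_mul₀ h1, h2]
  have hfst : ∀ n, (B n).1.fst = (Real.sqrt (1 + lam n))⁻¹ • e n := fun n => by
    change (Real.sqrt (1 + lam n))⁻¹ • (E n).1.fst = _
    rw [hE]
  have hon : Orthonormal ℝ B := by
    rw [orthonormal_iff_ite]
    intro n m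
    rw [hB, hfst, real_inner_smul_right, orthonormal_iff_ite.1 e.orthonormal n m]
    split_ifs with h
    · subst h
      rw [mul_one, mul_inv_cancel₀ (Real.sqrt_pos.2 (hpos n)).ne']
    · simp
  refine ⟨HilbertBasis.mkOfOrthogonalEqBot hon ?_, fun n p => by
    rw [HilbertBasis.coe_mkOfOrthogonalEqBot, hB]⟩
  rw [Submodule.eq_bot_iff]
  intro p hp
  -- Energy-orthogonality to every `B n` is `L₂`-orthogonality of the first component to every `eₙ`,
  -- so completeness in `L₂` gives completeness in the energy space.
  have h0 : ∀ n, inner ℝ (e n) p.1.fst = (0 : ℝ) := fun n => by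
    have h := (Submodule.mem_orthogonal _ p).1 hp (B n) (Submodule.subset_span ⟨n, rfl⟩)
    rw [hB] at h
    exact (mul_eq_zero.1 h).resolve_left (Real.sqrt_pos.2 (hpos n)).ne'
  refine energySpace_ext hD ?_
  have h1 : e.repr p.1.fst = 0 := by
    ext n
    rw [e.repr_apply_apply, h0]
    rfl
  exact (LinearIsometryEquiv.map_eq_zero_iff _).1 h1

theorem IsEigenbasis.hasSum_form (hD : IsOpen D) (hκ : IsWeight D κ)
    {lam : ℕ → ℝ} {e : HilbertBasis ℕ ℝ (L2 D)} (he : IsEigenbasis D κ lam e) {v w : L2 D}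
    (hv : MemH10 D v) (hw : MemH10 D w) :
    HasSum (fun n => lam n * inner ℝ v (e n) * inner ℝ w (e n)) (form D κ v w) := by
  obtain ⟨M, hM⟩ := hκ.exists_sqrt_mul
  obtain ⟨b, hb⟩ := he.exists_hilbertBasis hD hκ hM
  obtain ⟨p, rfl⟩ := hv.exists_energySpace hD M
  obtain ⟨q, rfl⟩ := hw.exists_energySpace hD M
  -- Parseval in the energy space has terms weighted by `1 + λₙ`; subtracting Parseval in `L₂`
  -- leaves the weight `λₙ` and the form.
  have h := (b.hasSum_inner_mul_inner p q).sub (e.hasSum_inner_mul_inner p.1.fst q.1.fst)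
  rw [inner_energySpace hD hκ hM, add_sub_cancel_left] at h
  refine h.congr_fun fun n => ?_
  have h2 := Real.mul_self_sqrt (by linarith [he.pos n] : 0 ≤ 1 + lam n)
  rw [real_inner_comm (b n) p, hb, hb, real_inner_comm (e n) p.1.fst, real_inner_comm (e n) q.1.fst]
  linear_combination (-inner ℝ (e n) p.1.fst * inner ℝ (e n) q.1.fst : ℝ) * h2

theorem IsEigenbasis.memH10_iff_summable (hD : IsOpen D) (hκ : IsWeight D κ)
    {lam : ℕ → ℝ} {e : HilbertBasis ℕ ℝ (L2 D)} (he : IsEigenbasis D κ lam e) (v : L2 D) :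
    MemH10 D v ↔ Summable fun n => lam n * inner ℝ v (e n) ^ 2 := by
  refine ⟨fun hv => ?_, fun hv => ?_⟩
  · simpa only [mul_assoc, ← pow_two] using (he.hasSum_form hD hκ hv hv).summable
  obtain ⟨M, hM⟩ := hκ.exists_sqrt_mul
  obtain ⟨b, hb⟩ := he.exists_hilbertBasis hD hκ hM
  have hpos : ∀ n, 0 < 1 + lam n := fun n => by linarith [he.pos n]
  have hs : Summable fun n => ‖Real.sqrt (1 + lam n) * inner ℝ (e n) v‖ ^ 2 := by
    refine (hv.add (e.summable_inner_mul_inner v v)).congr fun n => ?_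
    rw [Real.norm_eq_abs, sq_abs, mul_pow, Real.sq_sqrt (hpos n).le, real_inner_comm (e n) v]
    ring
  -- These are the coefficients `v` would have in the energy basis. Being square summable they
  -- define an element of the energy space, whose first component has the same `L₂` coefficients as
  -- `v`.
  let c : lp (fun _ : ℕ => ℝ) 2 := ⟨fun n => Real.sqrt (1 + lam n) * inner ℝ (e n) v,
    memℓp_gen (by simpa using hs)⟩
  have h : (b.repr.symm c).1.fst = v := by
    refine e.repr.injective (lp.ext (funext fun n => ?_))
    rw [e.repr_apply_apply, e.repr_apply_apply]
    have h1 : inner ℝ (b n) (b.repr.symm c) = c n := by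
      rw [← b.repr_apply_apply, LinearIsometryEquiv.apply_symm_apply]
    rw [hb] at h1
    exact mul_left_cancel₀ (Real.sqrt_pos.2 (hpos n)).ne' h1
  rw [← h]
  exact memH10_fst _

variable {β k : ℝ}

/-! ### The scalar resolvent of the nonlinearity -/

/-- The inverse of `s ↦ s + k (s³ - β² s)` is smooth. -/
theorem exists_scalar_resolvent (hk : 0 < k) (hkβ : k * β ^ 2 < 1) :
    ∃ g : ℝ → ℝ, ContDiff ℝ ∞ g ∧ (∀ s, g s + k * (g s ^ 3 - β ^ 2 * g s) = s) ∧
      ∀ s, HasDerivAt g (1 + k * (3 * g s ^ 2 - β ^ 2))⁻¹ s := by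
  let φ : ℝ → ℝ := fun s => s + k * (s ^ 3 - β ^ 2 * s)
  have hpos : ∀ s : ℝ, 0 < 1 + k * (3 * s ^ 2 - β ^ 2) := fun s => by
    have := mul_nonneg hk.le (sq_nonneg s)
    linarith
  have hderiv : ∀ s, HasDerivAt φ (1 + k * (3 * s ^ 2 - β ^ 2)) s := fun s => by
    have h := (hasDerivAt_id s).add
      (((hasDerivAt_pow 3 s).sub ((hasDerivAt_id s).const_mul (β ^ 2))).const_mul k)
    exact h.congr_deriv (by norm_num)
  have hsm : ContDiff ℝ ∞ φ := by fun_prop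
  have hmono : StrictMono φ := strictMono_of_deriv_pos fun s => by
    rw [(hderiv s).deriv]
    exact hpos s
  -- For `s ≥ 0` the cubic term only helps, so `φ s ≥ (1 - kβ²) s`. Oddness then settles the limit
  -- at `-∞`.
  have htop : Tendsto φ atTop atTop := by
    refine tendsto_atTop_mono' _ ?_ (tendsto_id.const_mul_atTop (sub_pos.2 hkβ))
    filter_upwards [eventually_ge_atTop 0] with s hs
    have := mul_nonneg hk.le (pow_nonneg hs 3)
    simp only [φ, id]
    linarith
  have hodd : ∀ s, φ (-s) = -φ s := fun s => by simp only [φ]; ring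
  have hbot : Tendsto φ atBot atBot := by
    have h := tendsto_neg_atTop_atBot.comp (htop.comp tendsto_neg_atBot_atTop)
    refine h.congr fun s => ?_
    simp [hodd]
  let Φ : ℝ ≃o ℝ := hmono.orderIsoOfSurjective φ (hsm.continuous.surjective htop hbot)
  have hΦ : ⇑Φ.toHomeomorph = φ := rfl
  have hinv : ∀ s, φ (Φ.symm s) = s := fun s => Φ.apply_symm_apply s
  refine ⟨Φ.symm, ?_, hinv, fun s => ?_⟩
  · exact Φ.toHomeomorph.contDiff_symm_deriv (fun s => (hpos s).ne') hderiv hsm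
  · exact (hderiv (Φ.symm s)).of_local_left_inverse Φ.symm.continuous.continuousAt
      (hpos _).ne' (Eventually.of_forall hinv)

/-- Factoring `a³ - b³` exhibits the difference quotient of the cubic as `1 - kβ² + kP` with `P = a²
+ ab + b² ≥ 0`; the scalar estimates are read off from it. -/
theorem scalar_sub_eq {g : ℝ → ℝ} (hg : ∀ s, g s + k * (g s ^ 3 - β ^ 2 * g s) = s) (s t : ℝ) :
    s - t = (g s - g t) * (1 - k * β ^ 2 + k * (g s ^ 2 + g s * g t + g t ^ 2)) := by
  linear_combination hg t - hg s

theorem sq_add_mul_add_sq_nonneg (a b : ℝ) : 0 ≤ a ^ 2 + a * b + b ^ 2 := by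
  nlinarith [sq_nonneg (a + b), sq_nonneg a, sq_nonneg b]

theorem abs_scalar_sub_le (hk : 0 < k) (hkβ : k * β ^ 2 < 1) {g : ℝ → ℝ}
    (hg : ∀ s, g s + k * (g s ^ 3 - β ^ 2 * g s) = s) (s t : ℝ) :
    |g s - g t| ≤ (1 - k * β ^ 2)⁻¹ * |s - t| := by
  have hq : 0 < 1 - k * β ^ 2 := by linarith
  have hP := mul_nonneg hk.le (sq_add_mul_add_sq_nonneg (g s) (g t))
  rw [inv_mul_eq_div, le_div_iff₀ hq, scalar_sub_eq hg s t, abs_mul,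
    abs_of_nonneg (add_nonneg hq.le hP)]
  exact mul_le_mul_of_nonneg_left (by linarith) (abs_nonneg _)

/-- The quotient of the two differences is `(kP - kβ²) / (1 - kβ² + kP)`, and it lies in `[-1, 1]`
because `2kβ² < 1` and `P ≥ 0`. This gives the constant `1/k` for `f_k` with no loss. -/
theorem abs_scalar_yosida_sub_le (hk : 0 < k) (hkβ : 2 * k * β ^ 2 < 1) {g : ℝ → ℝ}
    (hg : ∀ s, g s + k * (g s ^ 3 - β ^ 2 * g s) = s) (s t : ℝ) :
    |(s - g s) - (t - g t)| ≤ |s - t| := by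
  have hP := mul_nonneg hk.le (sq_add_mul_add_sq_nonneg (g s) (g t))
  have hβ := mul_nonneg hk.le (sq_nonneg β)
  set P := g s ^ 2 + g s * g t + g t ^ 2
  have h1 := scalar_sub_eq hg s t
  have h2 : (s - g s) - (t - g t) = (g s - g t) * (k * P - k * β ^ 2) := by
    linear_combination h1
  rw [h2, h1, abs_mul, abs_mul]
  refine mul_le_mul_of_nonneg_left ?_ (abs_nonneg _)
  rw [abs_of_nonneg (by linarith : 0 ≤ 1 - k * β ^ 2 + k * P), abs_le]
  constructor <;> linarith

theorem scalar_zero (hk : 0 < k) (hkβ : k * β ^ 2 < 1) {g : ℝ → ℝ}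
    (hg : ∀ s, g s + k * (g s ^ 3 - β ^ 2 * g s) = s) : g 0 = 0 := by
  have h1 : g 0 * (1 - k * β ^ 2 + k * g 0 ^ 2) = 0 := by linear_combination hg 0
  have h2 := mul_nonneg hk.le (sq_nonneg (g 0))
  exact (mul_eq_zero.1 h1).resolve_right (by linarith)

/-! ### The resolvent of the nonlinearity in `L₂(D)` -/

theorem memLp_pow_three_iff {α : Type*} [MeasurableSpace α] {μ : Measure α} {z : α → ℝ}
    (hz : AEStronglyMeasurable z μ) : MemLp (fun ξ => z ξ ^ 3) 2 μ ↔ MemLp z 6 μ := by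
  have h := memLp_norm_rpow_iff (p := 6) (q := 3) hz (by norm_num) (by norm_num)
  have h2 : (6 : ℝ≥0∞) / 3 = 2 := by
    rw [eq_comm, ENNReal.eq_div_iff (by norm_num) (by norm_num)]
    norm_num
  rw [h2] at h
  rw [← h, ← memLp_norm_iff (f := fun ξ => z ξ ^ 3) (hz.pow 3)]
  simp

theorem memDomF_of_memLp {z : L2 D} (hz : MemLp z 6 (volume.restrict D)) : MemDomF D β z :=
  ((memLp_pow_three_iff (Lp.memLp z).aestronglyMeasurable).2 hz).sub ((Lp.memLp z).const_mul _)

/-- The equation in `L₂` holds a.e. pointwise and the scalar equation has only one root, so the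
resolvent is composition with `g`; existence, uniqueness and all bounds for `J_k` reduce to scalar
facts. -/
theorem isJSol_iff {g : ℝ → ℝ} (hk : 0 < k) (hkβ : k * β ^ 2 < 1)
    (hg : ∀ s, g s + k * (g s ^ 3 - β ^ 2 * g s) = s) {x z : L2 D} :
    IsJSol D β k x z ↔ z =ᵐ[volume.restrict D] fun ξ => g (x ξ) := by
  have hf : ∀ {z : L2 D}, MemDomF D β z → z + k • f D β z =ᵐ[volume.restrict D]
      fun ξ => z ξ + k * (z ξ ^ 3 - β ^ 2 * z ξ) := fun {z} hz => by
    rw [f, dif_pos hz]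
    filter_upwards [Lp.coeFn_add z (k • MemLp.toLp _ hz), Lp.coeFn_smul k (MemLp.toLp _ hz),
      MemLp.coeFn_toLp hz] with ξ h1 h2 h3
    rw [h1, Pi.add_apply, h2, Pi.smul_apply, h3, smul_eq_mul]
  constructor
  · rintro ⟨hz, hx⟩
    filter_upwards [hf (memDomF_of_memLp hz)] with ξ h
    rw [hx] at h
    have h1 : (z ξ - g (x ξ)) *
        (1 - k * β ^ 2 + k * (z ξ ^ 2 + z ξ * g (x ξ) + g (x ξ) ^ 2)) = 0 := by
      linear_combination -h - hg (x ξ)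
    have hP := mul_nonneg hk.le (sq_add_mul_add_sq_nonneg (z ξ) (g (x ξ)))
    exact sub_eq_zero.1 ((mul_eq_zero.1 h1).resolve_right (by linarith))
  · intro hz
    -- The equation itself gives the integrability: `z³ = k⁻¹ (x - (1 - kβ²) z)` lies in `L₂`, that
    -- is, `z ∈ L₆`.
    have h6 : MemLp z 6 (volume.restrict D) := by
      rw [← memLp_pow_three_iff (Lp.memLp z).aestronglyMeasurable]
      refine MemLp.ae_eq ?_
        (((Lp.memLp x).sub ((Lp.memLp z).const_mul (1 - k * β ^ 2))).const_mul k⁻¹)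
      filter_upwards [hz] with ξ h
      have h1 := hg (x ξ)
      rw [← h] at h1
      rw [Pi.sub_apply, inv_mul_eq_iff_eq_mul₀ hk.ne']
      linear_combination -h1
    refine ⟨h6, Lp.ext ?_⟩
    filter_upwards [hf (memDomF_of_memLp h6), hz] with ξ h1 h2
    rw [h1, h2, hg]

theorem exists_isJSol (hk : 0 < k) (hkβ : k * β ^ 2 < 1) (x : L2 D) :
    ∃ z, IsJSol D β k x z := by
  obtain ⟨g, hsm, hg, -⟩ := exists_scalar_resolvent hk hkβ
  have h0 := scalar_zero hk hkβ hg
  have hm : MemLp (fun ξ => g (x ξ)) 2 (volume.restrict D) := by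
    refine ((Lp.memLp x).norm.const_mul (1 - k * β ^ 2)⁻¹).mono'
      (hsm.continuous.comp_aestronglyMeasurable (Lp.memLp x).aestronglyMeasurable)
      (ae_of_all _ fun ξ => ?_)
    simpa [h0] using abs_scalar_sub_le hk hkβ hg (x ξ) 0
  exact ⟨hm.toLp _, (isJSol_iff hk hkβ hg).2 hm.coeFn_toLp⟩

theorem isJSol_J (hk : 0 < k) (hkβ : k * β ^ 2 < 1) (x : L2 D) :
    IsJSol D β k x (J D β k x) := by
  have h := exists_isJSol hk hkβ x
  rw [J, dif_pos h]
  exact h.choose_spec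

theorem IsJSol.unique (hk : 0 < k) (hkβ : k * β ^ 2 < 1) {x z w : L2 D} (hz : IsJSol D β k x z)
    (hw : IsJSol D β k x w) : z = w := by
  obtain ⟨g, -, hg, -⟩ := exists_scalar_resolvent hk hkβ
  exact Lp.ext (((isJSol_iff hk hkβ hg).1 hz).trans ((isJSol_iff hk hkβ hg).1 hw).symm)

theorem sub_J_eq (hk : 0 < k) (hkβ : k * β ^ 2 < 1) (x : L2 D) :
    x - J D β k x = k • fk D β k x :=
  sub_eq_of_eq_add' (isJSol_J hk hkβ x).2.symm

theorem fk_eq (hk : 0 < k) (hkβ : k * β ^ 2 < 1) (x : L2 D) :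
    fk D β k x = k⁻¹ • (x - J D β k x) := by
  rw [sub_J_eq hk hkβ, inv_smul_smul₀ hk.ne']

theorem J_zero (hk : 0 < k) (hkβ : k * β ^ 2 < 1) : J D β k 0 = 0 := by
  refine (isJSol_J hk hkβ 0).unique hk hkβ ?_
  have h6 : MemLp (0 : L2 D) 6 (volume.restrict D) :=
    MemLp.ae_eq (Lp.coeFn_zero _ _ _).symm MemLp.zero'
  refine ⟨h6, ?_⟩
  have hf : f D β (0 : L2 D) = 0 := by
    rw [f, dif_pos (memDomF_of_memLp h6)]
    refine Lp.ext ?_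
    filter_upwards [MemLp.coeFn_toLp (memDomF_of_memLp (β := β) h6),
      Lp.coeFn_zero ℝ 2 (volume.restrict D)] with ξ h1 h2
    rw [h1, h2]
    simp
  rw [hf, smul_zero, add_zero]

theorem norm_J_sub_le (hk : 0 < k) (hkβ : k * β ^ 2 < 1) (x y : L2 D) :
    ‖J D β k x - J D β k y‖ ≤ (1 - k * β ^ 2)⁻¹ * ‖x - y‖ := by
  obtain ⟨g, -, hg, -⟩ := exists_scalar_resolvent hk hkβ
  refine Lp.norm_le_mul_norm_of_ae_le_mul ?_
  filter_upwards [Lp.coeFn_sub (J D β k x) (J D β k y), Lp.coeFn_sub x y,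
    (isJSol_iff hk hkβ hg).1 (isJSol_J hk hkβ x),
    (isJSol_iff hk hkβ hg).1 (isJSol_J hk hkβ y)] with ξ h1 h2 h3 h4
  rw [h1, h2, Pi.sub_apply, Pi.sub_apply, h3, h4]
  exact abs_scalar_sub_le hk hkβ hg _ _

theorem norm_fk_sub_le (hk : 0 < k) (hkβ : 2 * k * β ^ 2 < 1) (x y : L2 D) :
    ‖fk D β k x - fk D β k y‖ ≤ 1 / k * ‖x - y‖ := by
  have hkβ' : k * β ^ 2 < 1 := by nlinarith [mul_nonneg hk.le (sq_nonneg β)]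
  obtain ⟨g, -, hg, -⟩ := exists_scalar_resolvent hk hkβ'
  rw [fk_eq hk hkβ', fk_eq hk hkβ', ← smul_sub, norm_smul, norm_inv, Real.norm_eq_abs,
    abs_of_pos hk, one_div]
  refine mul_le_mul_of_nonneg_left ?_ (inv_nonneg.2 hk.le)
  refine Lp.norm_le_norm_of_ae_le ?_
  filter_upwards [Lp.coeFn_sub (x - J D β k x) (y - J D β k y), Lp.coeFn_sub x (J D β k x),
    Lp.coeFn_sub y (J D β k y), Lp.coeFn_sub x y,
    (isJSol_iff hk hkβ' hg).1 (isJSol_J hk hkβ' x),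
    (isJSol_iff hk hkβ' hg).1 (isJSol_J hk hkβ' y)] with ξ h1 h2 h3 h4 h5 h6
  rw [h1, Pi.sub_apply, h2, h3, h4, Pi.sub_apply, Pi.sub_apply, Pi.sub_apply, h5, h6]
  exact abs_scalar_yosida_sub_le hk hkβ hg _ _

/-- The chain rule for `g`, with `0 < g' ≤ (1 - kβ²)⁻¹`. Keeping the gradient bound pointwise lets
it be multiplied by `√κ`, so the same constant serves the weighted norm. -/
theorem exists_gradient_J (hD : IsOpen D) (hk : 0 < k) (hkβ : k * β ^ 2 < 1) {x : L2 D}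
    (hx : MemH10 D x) : ∃ W : L2Vec D, (J D β k x, W) ∈ gradientGraph D ∧
      ∀ᵐ ξ ∂volume.restrict D, ‖W ξ‖ ≤ (1 - k * β ^ 2)⁻¹ * ‖weakGrad D x ξ‖ := by
  obtain ⟨g, hsm, hg, hg'⟩ := exists_scalar_resolvent hk hkβ
  have hq : 0 < 1 - k * β ^ 2 := by linarith
  have hL : ∀ s, |(1 + k * (3 * g s ^ 2 - β ^ 2))⁻¹| ≤ (1 - k * β ^ 2)⁻¹ := fun s => by
    have := mul_nonneg hk.le (sq_nonneg (g s))
    have h1 : 1 - k * β ^ 2 ≤ 1 + k * (3 * g s ^ 2 - β ^ 2) := by linarith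
    rw [abs_of_nonneg (inv_nonneg.2 (hq.le.trans h1))]
    exact inv_anti₀ hq h1
  have h0 := scalar_zero hk hkβ hg
  have hbd : ∀ ξ, ‖(1 + k * (3 * g (x ξ) ^ 2 - β ^ 2))⁻¹ • weakGrad D x ξ‖ ≤
      (1 - k * β ^ 2)⁻¹ * ‖weakGrad D x ξ‖ := fun ξ => by
    rw [norm_smul]
    exact mul_le_mul_of_nonneg_right (hL _) (norm_nonneg _)
  have hgx : AEMeasurable (fun ξ => g (x ξ)) (volume.restrict D) :=
    hsm.continuous.measurable.comp_aemeasurable (Lp.memLp x).aestronglyMeasurable.aemeasurable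
  have hm : MemLp (fun ξ => (1 + k * (3 * g (x ξ) ^ 2 - β ^ 2))⁻¹ • weakGrad D x ξ) 2
      (volume.restrict D) :=
    ((Lp.memLp (weakGrad D x)).norm.const_mul _).mono'
      ((((((hgx.pow_const 2).const_mul 3).sub_const _).const_mul k).const_add
        1).inv.aestronglyMeasurable.smul (Lp.memLp (weakGrad D x)).aestronglyMeasurable)
      (ae_of_all _ hbd)
  refine ⟨hm.toLp _, comp_mem_gradientGraph hsm h0 hg' hL (hx.mem_gradientGraph hD)
    ((isJSol_iff hk hkβ hg).1 (isJSol_J hk hkβ x)) hm.coeFn_toLp, ?_⟩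
  filter_upwards [hm.coeFn_toLp] with ξ h
  rw [h]
  exact hbd ξ

theorem MemH10.J (hD : IsOpen D) (hk : 0 < k) (hkβ : k * β ^ 2 < 1) {x : L2 D}
    (hx : MemH10 D x) : MemH10 D (J D β k x) := by
  obtain ⟨W, hW, -⟩ := exists_gradient_J hD hk hkβ hx
  exact memH10_iff.2 ⟨W, hW⟩

theorem MemH10.fk (hD : IsOpen D) (hk : 0 < k) (hkβ : k * β ^ 2 < 1) {x : L2 D}
    (hx : MemH10 D x) : MemH10 D (fk D β k x) := by
  rw [fk_eq hk hkβ]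
  exact (hx.sub (hx.J hD hk hkβ)).smul _

theorem norm1_J_le (hD : IsOpen D) (hκ : IsWeight D κ) (hk : 0 < k) (hkβ : k * β ^ 2 < 1)
    {x : L2 D} (hx : MemH10 D x) :
    norm1 D κ (J D β k x) ≤ (1 - k * β ^ 2)⁻¹ * norm1 D κ x := by
  obtain ⟨M, hM⟩ := hκ.exists_sqrt_mul
  obtain ⟨W, hW, hbd⟩ := exists_gradient_J hD hk hkβ hx
  simp only [norm1, form_eq_inner hκ hM, ← norm_eq_sqrt_real_inner, weakGrad_eq hD hW]
  refine Lp.norm_le_mul_norm_of_ae_le_mul ?_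
  filter_upwards [hM W, hM (weakGrad D x), hbd] with ξ h1 h2 h3
  rw [h1, h2, norm_smul, norm_smul, mul_left_comm]
  exact mul_le_mul_of_nonneg_left h3 (norm_nonneg _)

/-! ### Dissipativity -/

theorem hasYosidaProperties_fk (hD : IsOpen D) (hκ : IsWeight D κ) (hk : 0 < k)
    (hkβ : 2 * k * β ^ 2 < 1) :
    HasYosidaProperties D κ (1 / k) (β ^ 2 / (1 - 2 * k * β ^ 2)) (fk D β k) := by
  have hkβ0 : 0 ≤ k * β ^ 2 := mul_nonneg hk.le (sq_nonneg β)
  have hkβ' : k * β ^ 2 < 1 := by linarith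
  have hq : 0 < 1 - k * β ^ 2 := by linarith
  -- Common arithmetic for both scalar products: `s` is a squared norm, `t` the pairing with `J_k`,
  -- `r` the pairing with `f_k`. It uses `k⁻¹ (1 - (1 - kβ²)⁻¹) = -β² / (1 - kβ²)`, which is at
  -- least `-b`.
  have hb : ∀ {r s t : ℝ}, 0 ≤ s → t ≤ (1 - k * β ^ 2)⁻¹ * s → r = k⁻¹ * (s - t) →
      r ≥ -(β ^ 2 / (1 - 2 * k * β ^ 2)) * s := fun {r s t} hs ht hr => by
    have h1 : k⁻¹ * (s - (1 - k * β ^ 2)⁻¹ * s) = -(β ^ 2 / (1 - k * β ^ 2)) * s := by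
      field_simp
      ring
    have h2 : β ^ 2 / (1 - k * β ^ 2) ≤ β ^ 2 / (1 - 2 * k * β ^ 2) :=
      div_le_div_of_nonneg_left (sq_nonneg β) (by linarith) (by linarith)
    calc -(β ^ 2 / (1 - 2 * k * β ^ 2)) * s ≤ -(β ^ 2 / (1 - k * β ^ 2)) * s :=
          mul_le_mul_of_nonneg_right (neg_le_neg h2) hs
      _ = k⁻¹ * (s - (1 - k * β ^ 2)⁻¹ * s) := h1.symm
      _ ≤ k⁻¹ * (s - t) := mul_le_mul_of_nonneg_left (by linarith) (inv_nonneg.2 hk.le)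
      _ = r := hr.symm
  have hone : ∀ x y : L2 D, inner ℝ (fk D β k x - fk D β k y) (x - y) ≥
      -(β ^ 2 / (1 - 2 * k * β ^ 2)) * ‖x - y‖ ^ 2 := fun x y => by
    refine hb (sq_nonneg _) (t := inner ℝ (J D β k x - J D β k y) (x - y)) ?_ ?_
    · calc inner ℝ (J D β k x - J D β k y) (x - y) ≤ ‖J D β k x - J D β k y‖ * ‖x - y‖ :=
            real_inner_le_norm _ _
        _ ≤ (1 - k * β ^ 2)⁻¹ * ‖x - y‖ * ‖x - y‖ :=
            mul_le_mul_of_nonneg_right (norm_J_sub_le hk hkβ' x y) (norm_nonneg _)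
        _ = (1 - k * β ^ 2)⁻¹ * ‖x - y‖ ^ 2 := by ring
    · rw [fk_eq hk hkβ', fk_eq hk hkβ', ← smul_sub, real_inner_smul_left, sub_sub_sub_comm,
        inner_sub_left, real_inner_self_eq_norm_sq]
  refine ⟨norm_fk_sub_le hk hkβ, hone, fun x => ?_, fun x hx => hx.fk hD hk hkβ', fun x hx => ?_⟩
  · have h0 : fk D β k 0 = 0 := by rw [fk_eq hk hkβ', J_zero hk hkβ', sub_zero, smul_zero]
    simpa [h0] using hone x 0
  · refine hb (sq_nonneg _) (t := form D κ (J D β k x) x) ?_ ?_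
    · calc form D κ (J D β k x) x ≤ norm1 D κ (J D β k x) * norm1 D κ x :=
            form_le_norm1_mul hκ _ _
        _ ≤ (1 - k * β ^ 2)⁻¹ * norm1 D κ x * norm1 D κ x :=
            mul_le_mul_of_nonneg_right (norm1_J_le hD hκ hk hkβ' hx) (Real.sqrt_nonneg _)
        _ = (1 - k * β ^ 2)⁻¹ * norm1 D κ x ^ 2 := by ring
    · have hJ := hx.J (β := β) hD hk hkβ'
      rw [fk_eq hk hkβ', form_smul_left hκ hD _ (hx.sub hJ), form_sub_left hκ hD hx hJ,
        norm1_sq hκ]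

/-- Symmetry moves the outer resolvent to the other argument, so the estimate for `g` applies at `R
x`; nonexpansiveness then replaces `R x` by `x`, where `b ≥ 0` fixes the direction of the
inequality. -/
theorem HasYosidaProperties.resolventA_conj (hD : IsOpen D) (hκ : IsWeight D κ) {ε L b : ℝ}
    (hε : 0 < ε) (hL : 0 ≤ L) (hb : 0 ≤ b) {g : L2 D → L2 D} (hg : HasYosidaProperties D κ L b g) :
    HasYosidaProperties D κ L b
      (fun x => resolventA D κ ε (g (resolventA D κ ε x))) where
  lipschitz x y := by
    rw [← resolventA_sub hD hκ hε]
    refine (norm_resolventA_le hD hκ hε _).trans ((hg.lipschitz _ _).trans ?_)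
    rw [← resolventA_sub hD hκ hε]
    exact mul_le_mul_of_nonneg_left (norm_resolventA_le hD hκ hε _) hL
  oneSided x y := by
    rw [← resolventA_sub hD hκ hε, inner_resolventA_comm hD hκ hε, resolventA_sub hD hκ hε]
    refine ge_trans (hg.oneSided _ _) ?_
    rw [← resolventA_sub hD hκ hε, neg_mul, neg_mul]
    exact neg_le_neg (mul_le_mul_of_nonneg_left
      (pow_le_pow_left₀ (norm_nonneg _) (norm_resolventA_le hD hκ hε _) 2) hb)
  dissipative x := by
    rw [inner_resolventA_comm hD hκ hε]
    refine ge_trans (hg.dissipative _) ?_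
    rw [neg_mul, neg_mul]
    exact neg_le_neg (mul_le_mul_of_nonneg_left
      (pow_le_pow_left₀ (norm_nonneg _) (norm_resolventA_le hD hκ hε _) 2) hb)
  mapsTo x _ := (isResolventSol_resolventA hD hκ hε _).1
  dissipative_one x hx := by
    have hR := (isResolventSol_resolventA hD hκ hε x).1
    rw [form_resolventA_comm hD hκ hε (hg.mapsTo _ hR) hx]
    refine ge_trans (hg.dissipative_one _ hR) ?_
    rw [neg_mul, neg_mul]
    exact neg_le_neg (mul_le_mul_of_nonneg_left
      (pow_le_pow_left₀ (Real.sqrt_nonneg _) (norm1_resolventA_le hD hκ hε hx) 2) hb)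

theorem isWeight_of_contDiffOn (hD : IsOpen D) (hDb : Bornology.IsBounded D)
    (hκ : ContDiffOn ℝ ∞ κ (closure D)) {κ₀ : ℝ} (hκ₀ : 0 < κ₀) (hκκ₀ : ∀ ξ ∈ D, κ₀ ≤ κ ξ) :
    IsWeight D κ where
  aestronglyMeasurable :=
    (hκ.continuousOn.mono subset_closure).aestronglyMeasurable hD.measurableSet
  lower := ⟨κ₀, hκ₀, (ae_restrict_iff' hD.measurableSet).2 (ae_of_all _ hκκ₀)⟩
  upper := by
    obtain ⟨C, hC⟩ := (hDb.isCompact_closure).bddAbove_image hκ.continuousOn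
    exact ⟨C, (ae_restrict_iff' hD.measurableSet).2
      (ae_of_all _ fun ξ hξ => hC ⟨ξ, subset_closure hξ, rfl⟩)⟩

/-- This is `1 - 2t ≤ (1 - t)²`; it converts the natural Lipschitz constant of `J_k` into `C(k)`,
with `t = kβ²`. -/
theorem inv_one_sub_le_one_div_sqrt {t : ℝ} (ht : 2 * t < 1) :
    (1 - t)⁻¹ ≤ 1 / Real.sqrt (1 - 2 * t) := by
  rw [one_div]
  refine inv_anti₀ (Real.sqrt_pos.2 (by linarith)) ?_
  exact Real.sqrt_le_iff.2 ⟨by linarith, by nlinarith [sq_nonneg t]⟩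

end AllenCahn

end

theorem mainTheorem5 {d : ℕ} (D : Set (Space d)) (hD : IsOpen D) (hDb : Bornology.IsBounded D)
    (κ : Space d → ℝ) (hκ : ContDiffOn ℝ ∞ κ (closure D))
    (κ₀ : ℝ) (hκ₀ : 0 < κ₀) (hκκ₀ : ∀ ξ ∈ D, κ₀ ≤ κ ξ)
    (β k : ℝ) (hk : 0 < k) (hkβ : 2 * k * β ^ 2 < 1) :
    -- `H¹₀(D)` with the form is the spectral space of order one, and `R_ε` is well defined
    (∀ (lam : ℕ → ℝ) (e : HilbertBasis ℕ ℝ (L2 D)), IsEigenbasis D κ lam e →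
      (∀ v : L2 D, MemH10 D v ↔ Summable fun n => lam n * inner ℝ v (e n) ^ 2) ∧
      ∀ v w : L2 D, MemH10 D v → MemH10 D w →
        HasSum (fun n => lam n * inner ℝ v (e n) * inner ℝ w (e n)) (form D κ v w)) ∧
    (∀ ε : ℝ, 0 < ε → ∀ x : L2 D,
      (∃! y : L2 D, IsResolventSol D κ ε x y) ∧
      IsResolventSol D κ ε x (resolventA D κ ε x)) ∧
    -- solvability of `z + k f(z) = x`
    (∀ x : L2 D, (∃! z : L2 D, IsJSol D β k x z) ∧
      IsJSol D β k x (J D β k x) ∧ MemDomF D β (J D β k x)) ∧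
    (∀ x : L2 D, MemH10 D x → MemH10 D (J D β k x) ∧ MemH10 D (fk D β k x)) ∧
    -- Lipschitz continuity and linear growth of `J_k`
    (∀ x y : L2 D, ‖J D β k x - J D β k y‖ ≤ 1 / Real.sqrt (1 - 2 * k * β ^ 2) * ‖x - y‖) ∧
    (∀ x : L2 D, MemH10 D x →
      norm1 D κ (J D β k x) ≤ 1 / Real.sqrt (1 - 2 * k * β ^ 2) * norm1 D κ x) ∧
    -- properties of `f_k` and `F_k`
    HasYosidaProperties D κ (1 / k) (β ^ 2 / (1 - 2 * k * β ^ 2)) (fk D β k) ∧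
    HasYosidaProperties D κ (1 / k) (β ^ 2 / (1 - 2 * k * β ^ 2)) (Fk D κ β k) ∧
    -- the Yosida identity
    (∀ x : L2 D, x - J D β k x = k • fk D β k x) ∧
    -- comparison of two step sizes
    (∀ a b : ℝ, 0 < a → 2 * a * β ^ 2 < 1 → 0 < b → 2 * b * β ^ 2 < 1 → ∀ x y : L2 D,
      inner ℝ (Fk D κ β a x - Fk D κ β b y) (x - y) =
        inner ℝ (fk D β a (resolventA D κ (a / 2) x) - fk D β b (resolventA D κ (b / 2) y))
          (resolventA D κ (a / 2) x - resolventA D κ (b / 2) y) +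
        inner ℝ (fk D β a (resolventA D κ (a / 2) x))
          (resolventA D κ (b / 2) y - resolventA D κ (a / 2) y) +
        inner ℝ (fk D β b (resolventA D κ (b / 2) y))
          (resolventA D κ (a / 2) x - resolventA D κ (b / 2) x)) := by
  have hκw : IsWeight D κ := isWeight_of_contDiffOn hD hDb hκ hκ₀ hκκ₀
  have hkβ0 : 0 ≤ k * β ^ 2 := mul_nonneg hk.le (sq_nonneg β)
  have hkβ' : k * β ^ 2 < 1 := by linarith
  have hC : (1 - k * β ^ 2)⁻¹ ≤ 1 / Real.sqrt (1 - 2 * k * β ^ 2) := by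
    rw [mul_assoc]
    exact inv_one_sub_le_one_div_sqrt (by linarith)
  have hfk := hasYosidaProperties_fk hD hκw hk hkβ
  refine ⟨fun lam e he => ⟨he.memH10_iff_summable hD hκw,
      fun v w hv hw => he.hasSum_form hD hκw hv hw⟩, fun ε hε x => ?_, fun x => ?_,
    fun x hx => ⟨hx.J hD hk hkβ', hx.fk hD hk hkβ'⟩,
    fun x y => (norm_J_sub_le hk hkβ' x y).trans
      (mul_le_mul_of_nonneg_right hC (norm_nonneg _)),
    fun x hx => (norm1_J_le hD hκw hk hkβ' hx).trans
      (mul_le_mul_of_nonneg_right hC (Real.sqrt_nonneg _)),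
    hfk, hfk.resolventA_conj hD hκw (half_pos hk) (one_div_nonneg.2 hk.le)
      (div_nonneg (sq_nonneg β) (by linarith)), sub_J_eq hk hkβ', fun a b ha _ hb _ x y => ?_⟩
  · have hR := isResolventSol_resolventA hD hκw hε x
    exact ⟨⟨_, hR, fun y hy => hy.unique hD hκw hε hR⟩, hR⟩
  · have hJ := isJSol_J hk hkβ' x
    exact ⟨⟨_, hJ, fun z hz => hz.unique hk hkβ' hJ⟩, hJ, memDomF_of_memLp hJ.1⟩
  -- Once the outer resolvents are moved to the second argument, both sides are the same combination
  -- of pairings of `f_a(R x)` and `f_b(R y)` with resolvents of `x` and `y`.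
  · simp only [Fk, inner_sub_left, inner_sub_right,
      inner_resolventA_comm hD hκw (half_pos ha), inner_resolventA_comm hD hκw (half_pos hb)]
    ring
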